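/- Let $G$ be a finite simple graph on $n$ vertices with maximum degree $\Delta=\Delta(G)$. The decentralized coloring algorithm on $G$ first gives every vertex a color from $\{1,\dots,\Delta+1\}$ independently and uniformly at random. While the current coloring is not proper, it performs a recoloring step: it picks a vertex $v$ uniformly at random among the vertices that have a neighbor of the same color, and then recolors $v$ with a uniformly random color from $\{1,\dots,\Delta+1\}$. Let $T_G\in\mathbb N\cup\{\infty\}$ be the number of recoloring steps until the coloring is proper. (i) If $\Delta=O(n^{1/4})$, then the algorithm terminates within $O(n\log\Delta)$ recoloring steps with high probability. Precisely, there is an absolute constant $C>0$ such that for every $K>0$ and every $\varepsilon>0$ there is an $N$ such that every graph $G$ on $n\ge N$ vertices with $\Delta\le K n^{1/4}$ satisfies $$\Pr\big[\,T_G\le C\,n\log\max\{\Delta,2\}\,\big]\ \ge\ 1-\varepsilon .$$ (ii) The same high-probability bound holds for every $\Delta$: there is an absolute constant $C>0$ such that for every $\varepsilon>0$ there is an $N$ such that every graph $G$ on $n\ge N$ vertices satisfies $$\Pr\big[\,T_G\le C\,n\log\max\{\Delta,2\}\,\big]\ \ge\ 1-\varepsilon .$$ For $\Delta\ge 2$ the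 bound is literally $C\,n\log\Delta$. -/

import Mathlib

open MeasureTheory ProbabilityTheory
open scoped ENNReal

namespace DecentralizedColoring

section
variable {V : Type*} [Fintype V] (G : SimpleGraph V) [DecidableRel G.Adj]

/-- The palette: a set of `Δ(G) + 1` colors. -/
abbrev Color : Type := Fin (G.maxDegree + 1)

/-- A not necessarily proper coloring of the vertices with the `Δ(G) + 1` colors. -/
abbrev ColorAssignment : Type _ := V → Color G

/-- No edge is monochromatic. -/
def IsProper (c : ColorAssignment G) : Prop :=
  ∀ u v : V, G.Adj u v → c u ≠ c v

/-- The vertices that have a neighbor of the same color. -/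
def conflicted (c : ColorAssignment G) : Finset V :=
  Finset.univ.filter fun v => ∃ u, G.Adj v u ∧ c u = c v

theorem conflicted_nonempty_iff (c : ColorAssignment G) :
    (conflicted G c).Nonempty ↔ ¬ IsProper G c := by
  constructor
  · rintro ⟨v, hv⟩ h
    obtain ⟨u, huv, hc⟩ := (Finset.mem_filter.mp hv).2
    exact h v u huv hc.symm
  · intro h
    simp only [IsProper, not_forall, not_not] at h
    obtain ⟨u, v, huv, hc⟩ := h
    exact ⟨u, Finset.mem_filter.mpr ⟨Finset.mem_univ _, v, huv, hc.symm⟩⟩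

variable [DecidableEq V]

/-- The law of the initial coloring. The uniform law on functions `V → Color G` is the one under
which the colors of the vertices are independent and uniform. -/
noncomputable def initial : PMF (ColorAssignment G) :=
  PMF.uniformOfFintype (ColorAssignment G)

/-- One recoloring step: a uniformly random conflicted vertex gets a uniformly random color
(possibly its old one). Once the coloring is proper, nothing changes any more. -/
noncomputable def step (c : ColorAssignment G) : PMF (ColorAssignment G) :=
  if h : (conflicted G c).Nonempty then
    (PMF.uniformOfFinset (conflicted G c) h).bind fun v =>
      (PMF.uniformOfFintype (Color G)).map fun x => Function.update c v x
  else PMF.pure c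

/-- The transition kernel of a recoloring step. -/
noncomputable def stepKernel : Kernel (ColorAssignment G) (ColorAssignment G) :=
  Kernel.ofFunOfCountable fun c => (step G c).toMeasure

instance : IsMarkovKernel (stepKernel G) :=
  ⟨fun c => inferInstanceAs (IsProbabilityMeasure (step G c).toMeasure)⟩

/-- The transition from time `t` to time `t + 1`, as a kernel on the whole history: it only looks
at the coloring at time `t`. -/
noncomputable def historyKernel (t : ℕ) :
    Kernel ((i : Finset.Iic t) → (fun _ : ℕ => ColorAssignment G) i) (ColorAssignment G) :=
  (stepKernel G).comap (fun h => h ⟨t, Finset.mem_Iic.mpr le_rfl⟩) (measurable_pi_apply _)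

instance (t : ℕ) : IsMarkovKernel (historyKernel G t) :=
  inferInstanceAs (IsMarkovKernel ((stepKernel G).comap _ _))

/-- The law of the whole run `c₀, c₁, c₂, …` of the algorithm: the Markov chain with initial law
`initial G` and transition law `step G`. -/
noncomputable def run : Measure (ℕ → ColorAssignment G) :=
  Kernel.trajMeasure (X := fun _ : ℕ => ColorAssignment G) (initial G).toMeasure
    (historyKernel G)

instance : IsProbabilityMeasure (run G) :=
  inferInstanceAs (IsProbabilityMeasure (Kernel.trajMeasure (X := fun _ : ℕ => ColorAssignment G)
    (initial G).toMeasure (historyKernel G)))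

/-- The number of recoloring steps until the coloring is proper (`⊤` if that never happens). -/
noncomputable def runtime (c : ℕ → ColorAssignment G) : ℕ∞ :=
  ⨅ t ∈ {t : ℕ | IsProper G (c t)}, (t : ℕ∞)

/-- The probability that the algorithm terminates after at most `s` recoloring steps. -/
noncomputable def probRuntimeLE (s : ℝ) : ℝ :=
  (run G).real {c | ((runtime G c : ℕ∞) : ℝ≥0∞) ≤ ENNReal.ofReal s}

end

end DecentralizedColoring

/-! Write k = Δ + 1 and let n be the number of vertices. Let U be the number of conflicted vertices
and M = `monoSum`. Let F be the number of free colors summed over conflicted vertices, and N the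
number of free colors of each vertex weighted by its number d of conflicted neighbors. A step
changes M + U by at most −(F + k(M − U)) / (kU) on average, which is weak when conflicted vertices
see almost all colors. That situation does not last: F gains at rate N up to O(kF), because
conflicts are passed on to neighbors with free colors, and N gains at rate k ∑ d² / 2 up to O(kN),
because recoloring a conflicted vertex usually frees a color around it. The potential Φ = M + U −
F/(10k) − N/(70k²) combines these effects (`stepSum_potential_le`).

Either the conflicted vertices have average degree at least k/2, and Cauchy–Schwarz bounds ∑ d² from
below, or F is at least kU/2. Both cases give the multiplicative drift E Φ' ≤ (1 − 1/(1120n)) Φ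
(`stepMean_potential_le_mul`). Moreover Φ drops on average by at least 1/(2k) while the coloring is
improper (`stepMean_potential_le_sub`).

Since Φ ≤ kn at the start, 3360 n log k steps bring its mean to at most n/k². Another 4n steps with
the additive drift leave failure probability O(1/k), which suffices for large k
(`meanAt_improper_le_of_le`). For bounded k a second-moment argument applies: a step changes Φ by at
most 4k, so the squared excess of Φ over a deterministic level that follows the drift grows only by
O(k²) per step. Letting the level fall to −n/k forces a failing run to have excess at least n/k, so
failure has probability O(k⁵/n) (`meanAt_improper_le_of_le'`). Both parts of the theorem follow from
this bound, which is uniform in Δ. -/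

namespace DecentralizedColoring

set_option linter.unusedSectionVars false

/-! ### Color counts around a vertex, and how one recoloring changes them -/

section
variable {V : Type*} [Fintype V] (G : SimpleGraph V) [DecidableRel G.Adj]

/-- The number of neighbors of `v` of color `x`. -/
def colorDegree (c : ColorAssignment G) (v : V) (x : Color G) : ℕ :=
  (Finset.univ.filter fun u => G.Adj v u ∧ c u = x).card

/-- The number of colors that no neighbor of `v` has. -/
def freeCount (c : ColorAssignment G) (v : V) : ℕ :=
  (Finset.univ.filter fun x => colorDegree G c v x = 0).card

/-- The number of colors, as a real number. -/
def palette : ℝ := (G.maxDegree : ℝ) + 1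

variable {G}

theorem palette_eq_card : palette G = (Fintype.card (Color G) : ℝ) := by
  simp [palette]

theorem one_le_palette : 1 ≤ palette G := by simp [palette]

theorem sum_color_const (a : ℝ) : ∑ _x : Color G, a = palette G * a := by
  simp [palette]

theorem mem_conflicted_iff (c : ColorAssignment G) (v : V) :
    v ∈ conflicted G c ↔ colorDegree G c v (c v) ≠ 0 := by
  simp [conflicted, colorDegree, Finset.filter_eq_empty_iff]

theorem colorDegree_eq_sum (c : ColorAssignment G) (v : V) (x : Color G) :
    (colorDegree G c v x : ℝ) = ∑ u, if G.Adj v u ∧ c u = x then 1 else 0 := by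
  simp [colorDegree]

theorem freeCount_eq_sum (c : ColorAssignment G) (v : V) :
    (freeCount G c v : ℝ) = ∑ x, if colorDegree G c v x = 0 then 1 else 0 := by
  simp [freeCount]

theorem degree_eq_sum (v : V) : (G.degree v : ℝ) = ∑ u, if G.Adj v u then 1 else 0 := by
  rw [← G.card_neighborFinset_eq_degree, G.neighborFinset_eq_filter]
  simp

theorem degree_add_one_le (v : V) : (G.degree v : ℝ) + 1 ≤ palette G := by
  have := G.degree_le_maxDegree v
  simpa [palette] using this

theorem freeCount_le (c : ColorAssignment G) (v : V) : (freeCount G c v : ℝ) ≤ palette G := by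
  rw [palette_eq_card]
  exact_mod_cast Finset.card_le_univ _

/-- Summing over the neighbors of `v` by color. -/
theorem sum_neighbors_color (c : ColorAssignment G) (v : V) (g : Color G → ℝ) :
    (∑ u, if G.Adj v u then g (c u) else 0) = ∑ z, colorDegree G c v z * g z := by
  simp_rw [colorDegree_eq_sum, Finset.sum_mul]
  rw [Finset.sum_comm]
  refine Finset.sum_congr rfl fun u _ => ?_
  by_cases h : G.Adj v u <;> simp [h]

theorem sum_colorDegree (c : ColorAssignment G) (v : V) :
    ∑ z, (colorDegree G c v z : ℝ) = G.degree v := by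
  have := sum_neighbors_color c v (fun _ => 1)
  rw [degree_eq_sum, this]; simp

theorem palette_le_degree_add_freeCount (c : ColorAssignment G) (v : V) :
    palette G ≤ G.degree v + freeCount G c v := by
  rw [← sum_colorDegree c, freeCount_eq_sum, ← Finset.sum_add_distrib, ← mul_one (palette G),
    ← sum_color_const]
  refine Finset.sum_le_sum fun x _ => ?_
  split_ifs with h
  · simp
  · have : (1 : ℝ) ≤ colorDegree G c v x := by exact_mod_cast Nat.one_le_iff_ne_zero.2 h
    linarith

theorem one_le_freeCount (c : ColorAssignment G) (v : V) : (1 : ℝ) ≤ freeCount G c v := by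
  linarith [palette_le_degree_add_freeCount c v, degree_add_one_le (G := G) v]

/-- The neighbors of `v` whose color is repeated in the neighborhood of `v` are outnumbered
by twice the free colors. -/
theorem card_repeated_le (c : ColorAssignment G) (v : V) :
    (∑ u, if G.Adj v u then (if colorDegree G c v (c u) = 1 then (0 : ℝ) else 1) else 0) ≤
      2 * freeCount G c v := by
  rw [sum_neighbors_color c v (fun z => if colorDegree G c v z = 1 then (0 : ℝ) else 1)]
  -- A color seen d ≥ 2 times contributes d ≤ 2(d − 1). Summing d − 1 + [d = 0] over all colors
  -- gives deg − k + free, which is less than the number of free colors.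
  have h : ∀ z, (colorDegree G c v z : ℝ) * (if colorDegree G c v z = 1 then (0 : ℝ) else 1) ≤
      2 * (colorDegree G c v z - 1 + if colorDegree G c v z = 0 then 1 else 0) := by
    intro z
    rcases Nat.lt_or_ge (colorDegree G c v z) 2 with h | h
    · interval_cases colorDegree G c v z <;> simp
    · have h' : (2 : ℝ) ≤ colorDegree G c v z := by exact_mod_cast h
      rw [if_neg (by omega), if_neg (by omega)]
      linarith
  refine (Finset.sum_le_sum fun z _ => h z).trans ?_
  rw [← Finset.mul_sum, Finset.sum_add_distrib, Finset.sum_sub_distrib, sum_color_const,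
    ← freeCount_eq_sum, sum_colorDegree]
  linarith [degree_add_one_le (G := G) v]

theorem colorDegree_le (c : ColorAssignment G) (v : V) (x : Color G) :
    (colorDegree G c v x : ℝ) + 1 ≤ palette G := by
  have : (colorDegree G c v x : ℝ) ≤ ∑ z, (colorDegree G c v z : ℝ) :=
    Finset.single_le_sum (f := fun z => (colorDegree G c v z : ℝ)) (fun _ _ => by positivity)
      (Finset.mem_univ x)
  linarith [sum_colorDegree c v, degree_add_one_le (G := G) v]

variable [DecidableEq V]

variable (G) in
/-- The number of conflicted neighbors of `v`. -/
def conflictDegree (c : ColorAssignment G) (v : V) : ℕ :=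
  (Finset.univ.filter fun u => G.Adj v u ∧ u ∈ conflicted G c).card

theorem conflictDegree_eq_sum (c : ColorAssignment G) (v : V) :
    (conflictDegree G c v : ℝ) =
      ∑ u, if G.Adj v u ∧ u ∈ conflicted G c then 1 else 0 := by
  simp [conflictDegree]

theorem conflictDegree_le_degree (c : ColorAssignment G) (v : V) :
    (conflictDegree G c v : ℝ) ≤ G.degree v := by
  rw [conflictDegree_eq_sum, degree_eq_sum]
  gcongr with u
  split_ifs <;> simp_all

theorem conflictDegree_le (c : ColorAssignment G) (v : V) :
    (conflictDegree G c v : ℝ) ≤ palette G := by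
  linarith [conflictDegree_le_degree c v, degree_add_one_le (G := G) v]

theorem colorDegree_update (c : ColorAssignment G) (v w : V) (x z : Color G) :
    colorDegree G (Function.update c v x) w z + (if G.Adj w v ∧ c v = z then 1 else 0) =
      colorDegree G c w z + (if G.Adj w v ∧ x = z then 1 else 0) := by
  simp only [colorDegree, Finset.card_filter]
  rw [← Finset.add_sum_erase _ _ (Finset.mem_univ v),
    ← Finset.add_sum_erase _ (fun u => if G.Adj w u ∧ c u = z then 1 else 0) (Finset.mem_univ v)]
  have : ∀ u ∈ Finset.univ.erase v,
      (if G.Adj w u ∧ Function.update c v x u = z then 1 else 0) =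
        if G.Adj w u ∧ c u = z then 1 else 0 := by
    intro u hu
    rw [Function.update_of_ne (Finset.ne_of_mem_erase hu)]
  rw [Finset.sum_congr rfl this]
  simp only [Function.update_self]
  ring

theorem colorDegree_update_self (c : ColorAssignment G) (v : V) (x z : Color G) :
    colorDegree G (Function.update c v x) v z = colorDegree G c v z := by
  simpa using colorDegree_update c v v x z

/-- Whether `w` loses its only conflict when `v` changes its color. -/
abbrev IsLeafOf (c : ColorAssignment G) (v w : V) : Prop :=
  G.Adj v w ∧ c w = c v ∧ colorDegree G c w (c w) = 1

/-- Membership of `w` changes in three ways only: a quiet neighbor of `v` already has the new color,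
a neighbor whose sole conflict was with `v` is released, or `v` itself receives a free color. -/
theorem conflicted_update_le (c : ColorAssignment G) (v w : V) (x : Color G)
    (hv : v ∈ conflicted G c) :
    (if w ∈ conflicted G (Function.update c v x) then (1 : ℝ) else 0) -
        (if w ∈ conflicted G c then 1 else 0) ≤
      (if G.Adj v w ∧ c w = x ∧ w ∉ conflicted G c then 1 else 0) -
        (if x ≠ c v ∧ IsLeafOf c v w then 1 else 0) -
        (if w = v ∧ colorDegree G c v x = 0 then 1 else 0) := by
  rcases eq_or_ne w v with rfl | hw
  · simp only [mem_conflicted_iff, colorDegree_update_self, Function.update_self, IsLeafOf,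
      G.irrefl, false_and, and_false, if_false, true_and] at hv ⊢
    by_cases h : colorDegree G c w x = 0 <;> simp [hv, h]
  · have h := colorDegree_update c v w x (c w)
    have h0 := G.adj_comm v w
    simp only [mem_conflicted_iff, Function.update_of_ne hw, IsLeafOf] at h ⊢
    grind

theorem leaves_of_not_mem_conflicted_update (c : ColorAssignment G) (v w : V) (x : Color G)
    (hw : w ∈ conflicted G c) (hw' : w ∉ conflicted G (Function.update c v x)) :
    IsLeafOf c v w ∨ (w = v ∧ colorDegree G c v x = 0) := by
  rcases eq_or_ne w v with rfl | hwv
  · simp only [mem_conflicted_iff, colorDegree_update_self, Function.update_self] at hw'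
    exact Or.inr ⟨rfl, by simpa using hw'⟩
  · left
    have h := colorDegree_update c v w x (c w)
    simp only [mem_conflicted_iff, Function.update_of_ne hwv, not_not] at hw hw'
    rw [hw'] at h
    split_ifs at h with h1 h2 h2 <;> try omega
    exact ⟨h1.1.symm, h1.2.symm, by omega⟩

theorem adj_of_mem_conflicted_update (c : ColorAssignment G) (v w : V) (x : Color G)
    (hw : w ∉ conflicted G c) (hwv : w ≠ v) (hw' : w ∈ conflicted G (Function.update c v x)) :
    G.Adj v w ∧ c w = x := by
  have h := colorDegree_update c v w x (c w)
  simp only [mem_conflicted_iff, Function.update_of_ne hwv, not_not] at hw hw'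
  rw [hw] at h
  split_ifs at h with h1 h2 h2 <;> try omega
  exact ⟨h2.1.symm, h2.2.symm⟩

theorem mem_conflicted_update_of_adj (c : ColorAssignment G) (v w : V)
    (h : G.Adj v w) : w ∈ conflicted G (Function.update c v (c w)) := by
  simp only [conflicted, Finset.mem_filter, Finset.mem_univ, true_and]
  exact ⟨v, h.symm, by simp [Function.update_of_ne h.ne']⟩

/-- Only two colors can change status at `y`: the old color of `v` becomes free if `v` was its only
carrier around `y`, and the new color stops being free. -/
theorem le_freeCount_update (c : ColorAssignment G) (v y : V) (x : Color G) :
    (freeCount G c y : ℝ) +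
        (if G.Adj y v ∧ colorDegree G c y (c v) = 1 ∧ x ≠ c v then 1 else 0) -
        (if G.Adj y v ∧ colorDegree G c y x = 0 then 1 else 0) ≤
      freeCount G (Function.update c v x) y := by
  have key : ∀ z, ((if colorDegree G c y z = 0 then (1 : ℝ) else 0) +
        (if z = c v then
          (if G.Adj y v ∧ colorDegree G c y (c v) = 1 ∧ x ≠ c v then 1 else 0) else 0)) -
        (if z = x then (if G.Adj y v ∧ colorDegree G c y x = 0 then 1 else 0) else 0) ≤
      (if colorDegree G (Function.update c v x) y z = 0 then 1 else 0) := by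
    intro z
    have h := colorDegree_update c v y x z
    grind
  have := Finset.sum_le_sum fun z (_ : z ∈ Finset.univ) => key z
  rw [Finset.sum_sub_distrib, Finset.sum_add_distrib, ← freeCount_eq_sum, ← freeCount_eq_sum,
    Finset.sum_ite_eq', Finset.sum_ite_eq'] at this
  simpa only [Finset.mem_univ, if_true] using this

theorem freeCount_update_le (c : ColorAssignment G) (v y : V) (x : Color G) :
    (freeCount G (Function.update c v x) y : ℝ) ≤
      freeCount G c y + (if G.Adj v y then 1 else 0) := by
  have key : ∀ z, (if colorDegree G (Function.update c v x) y z = 0 then (1 : ℝ) else 0) ≤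
      (if colorDegree G c y z = 0 then (1 : ℝ) else 0) +
        (if z = c v then (if G.Adj v y then 1 else 0) else 0) := by
    intro z
    have h := colorDegree_update c v y x z
    have h0 := G.adj_comm v y
    grind
  have := Finset.sum_le_sum fun z (_ : z ∈ Finset.univ) => key z
  rw [Finset.sum_add_distrib, ← freeCount_eq_sum, ← freeCount_eq_sum,
    Finset.sum_ite_eq'] at this
  simpa only [Finset.mem_univ, if_true] using this

end

/-! ### Total change of the four counts over all possible steps -/

section
variable {V : Type*} [Fintype V] [DecidableEq V] (G : SimpleGraph V) [DecidableRel G.Adj]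

/-- The number of ordered pairs of adjacent vertices of the same color. -/
noncomputable def monoSum (c : ColorAssignment G) : ℝ := ∑ v, (colorDegree G c v (c v) : ℝ)

/-- The number of conflicted vertices. -/
noncomputable def conflictCount (c : ColorAssignment G) : ℝ :=
  ∑ v, if v ∈ conflicted G c then 1 else 0

/-- The total number of free colors of the conflicted vertices. -/
noncomputable def freeSum (c : ColorAssignment G) : ℝ :=
  ∑ v, if v ∈ conflicted G c then (freeCount G c v : ℝ) else 0

/-- The total number of free colors of the neighbors of the conflicted vertices. -/
noncomputable def neighborFreeSum (c : ColorAssignment G) : ℝ :=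
  ∑ v, (freeCount G c v : ℝ) * conflictDegree G c v

/-- The total change of `h` over all possible recoloring steps. -/
noncomputable def stepSum (h : ColorAssignment G → ℝ) (c : ColorAssignment G) : ℝ :=
  ∑ v ∈ conflicted G c, ∑ x, (h (Function.update c v x) - h c)

variable {G}

theorem sum_color_ne (z : Color G) :
    ∑ x : Color G, (if x ≠ z then (1 : ℝ) else 0) = palette G - 1 := by
  have h : ∀ x, (if x ≠ z then (1 : ℝ) else 0) = 1 - if x = z then 1 else 0 := by
    intro x; split_ifs <;> simp_all
  simp_rw [h, Finset.sum_sub_distrib, sum_color_const]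
  simp

theorem sum_conflicted (c : ColorAssignment G) (F : V → ℝ) :
    ∑ v ∈ conflicted G c, F v = ∑ v, if v ∈ conflicted G c then F v else 0 := by
  simp

theorem sum_conflicted_monoSum (c : ColorAssignment G) :
    ∑ v ∈ conflicted G c, (colorDegree G c v (c v) : ℝ) = monoSum G c := by
  refine Finset.sum_subset (Finset.subset_univ _) fun v _ hv => ?_
  rw [mem_conflicted_iff, not_not] at hv
  simp [hv]

/-- Double counting: a vertex with exactly one neighbor of its own color is a leaf of that neighbor
alone, and that neighbor is conflicted. -/
theorem sum_leaves (c : ColorAssignment G) (F : V → ℝ) :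
    ∑ v ∈ conflicted G c, ∑ w, (if IsLeafOf c v w then F w else 0) =
      ∑ w, if colorDegree G c w (c w) = 1 then F w else 0 := by
  have h1 : ∑ v ∈ conflicted G c, ∑ w, (if IsLeafOf c v w then F w else 0) =
      ∑ v, ∑ w, (if IsLeafOf c v w then F w else 0) := by
    refine Finset.sum_subset (Finset.subset_univ _) fun v _ hv => ?_
    refine Finset.sum_eq_zero fun w _ => if_neg fun h => hv ?_
    simp only [conflicted, Finset.mem_filter, Finset.mem_univ, true_and]
    exact ⟨w, h.1, h.2.1⟩
  rw [h1, Finset.sum_comm]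
  refine Finset.sum_congr rfl fun w _ => ?_
  by_cases h : colorDegree G c w (c w) = 1
  · have h2 := colorDegree_eq_sum c w (c w)
    rw [h, Nat.cast_one] at h2
    have h3 : F w = ∑ v, (if G.Adj w v ∧ c v = c w then (1 : ℝ) else 0) * F w := by
      rw [← Finset.sum_mul, ← h2, one_mul]
    rw [if_pos h]
    refine Eq.trans ?_ h3.symm
    refine Finset.sum_congr rfl fun v _ => ?_
    have := G.adj_comm v w
    simp only [IsLeafOf]
    grind
  · simp [IsLeafOf, h]

theorem sum_leaves_le (c : ColorAssignment G) (F : V → ℝ) (hF : ∀ v, 0 ≤ F v) :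
    ∑ v ∈ conflicted G c, ∑ w, (if IsLeafOf c v w then F w else 0) ≤
      ∑ w, if w ∈ conflicted G c then F w else 0 := by
  rw [sum_leaves]
  refine Finset.sum_le_sum fun w _ => ?_
  have := hF w
  simp only [mem_conflicted_iff]
  grind

theorem sum_conflicted_neighbors (c : ColorAssignment G) (F : V → ℝ) :
    ∑ v ∈ conflicted G c, ∑ w, (if G.Adj v w then F w else 0) =
      ∑ w, conflictDegree G c w * F w := by
  rw [Finset.sum_comm]
  refine Finset.sum_congr rfl fun w _ => ?_
  rw [conflictDegree_eq_sum, Finset.sum_mul, sum_conflicted]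
  refine Finset.sum_congr rfl fun v _ => ?_
  have := G.adj_comm v w
  grind

theorem conflictCount_eq_card (c : ColorAssignment G) :
    conflictCount G c = (conflicted G c).card := by
  simp [conflictCount]

theorem conflictCount_le_freeSum (c : ColorAssignment G) : conflictCount G c ≤ freeSum G c := by
  refine Finset.sum_le_sum fun v _ => ?_
  have := one_le_freeCount c v
  split_ifs <;> simp [this]

theorem conflictCount_nonneg (c : ColorAssignment G) : 0 ≤ conflictCount G c := by
  rw [conflictCount_eq_card]; positivity

theorem freeSum_le (c : ColorAssignment G) : freeSum G c ≤ palette G * conflictCount G c := by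
  rw [freeSum, conflictCount, Finset.mul_sum]
  refine Finset.sum_le_sum fun v _ => ?_
  have := freeCount_le c v
  split_ifs <;> simp [this]

theorem sum_conflictDegree (c : ColorAssignment G) :
    ∑ v, (conflictDegree G c v : ℝ) = ∑ v ∈ conflicted G c, (G.degree v : ℝ) := by
  have := sum_conflicted_neighbors c (fun _ => 1)
  simp only [mul_one] at this
  rw [← this]
  simp_rw [degree_eq_sum]

theorem sum_degree_conflicted_le (c : ColorAssignment G) :
    ∑ v ∈ conflicted G c, (G.degree v : ℝ) ≤ (palette G - 1) * conflictCount G c := by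
  rw [conflictCount_eq_card, mul_comm, ← nsmul_eq_mul]
  refine Finset.sum_le_card_nsmul _ _ _ fun v _ => ?_
  linarith [degree_add_one_le (G := G) v]

theorem neighborFreeSum_le (c : ColorAssignment G) :
    neighborFreeSum G c ≤ palette G ^ 2 * conflictCount G c := by
  have h : neighborFreeSum G c ≤ palette G * ∑ v, (conflictDegree G c v : ℝ) := by
    rw [neighborFreeSum, Finset.mul_sum]
    gcongr with v
    exact freeCount_le c v
  rw [sum_conflictDegree] at h
  have := sum_degree_conflicted_le c
  have := conflictCount_nonneg c
  have := one_le_palette (G := G)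
  nlinarith [mul_le_mul_of_nonneg_left (sum_degree_conflicted_le c) (by linarith : 0 ≤ palette G)]

theorem monoSum_update (c : ColorAssignment G) (v : V) (x : Color G) :
    monoSum G (Function.update c v x) - monoSum G c =
      2 * (colorDegree G c v x - colorDegree G c v (c v)) := by
  have key : ∀ w, (colorDegree G (Function.update c v x) w (Function.update c v x w) : ℝ) -
      colorDegree G c w (c w) =
      (if w = v then (colorDegree G c v x : ℝ) - colorDegree G c v (c v) else 0) +
        ((if G.Adj v w ∧ c w = x then (1 : ℝ) else 0) -
          if G.Adj v w ∧ c w = c v then 1 else 0) := by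
    intro w
    rcases eq_or_ne w v with rfl | hw
    · simp [colorDegree_update_self]
    · have h := colorDegree_update c v w x (c w)
      have h0 := G.adj_comm v w
      have h' := congrArg (fun n : ℕ => (n : ℝ)) h
      push_cast at h'
      rw [Function.update_of_ne hw, if_neg hw]
      grind
  rw [monoSum, monoSum, ← Finset.sum_sub_distrib, Finset.sum_congr rfl fun w _ => key w,
    Finset.sum_add_distrib, Finset.sum_sub_distrib, ← colorDegree_eq_sum, ← colorDegree_eq_sum]
  simp
  ring

theorem stepSum_monoSum (c : ColorAssignment G) :
    stepSum G (monoSum G) c =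
      2 * ∑ v ∈ conflicted G c, (G.degree v : ℝ) - 2 * palette G * monoSum G c := by
  simp_rw [stepSum, monoSum_update, ← Finset.mul_sum, Finset.sum_sub_distrib, sum_colorDegree,
    sum_color_const, ← Finset.mul_sum, sum_conflicted_monoSum]
  ring

theorem two_mul_conflictCount_le (c : ColorAssignment G) :
    2 * conflictCount G c ≤
      monoSum G c + ∑ w, if colorDegree G c w (c w) = 1 then (1 : ℝ) else 0 := by
  rw [conflictCount, monoSum, Finset.mul_sum, ← Finset.sum_add_distrib]
  refine Finset.sum_le_sum fun w _ => ?_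
  simp only [mem_conflicted_iff]
  rcases Nat.lt_or_ge (colorDegree G c w (c w)) 2 with h | h
  · interval_cases colorDegree G c w (c w) <;> norm_num
  · have h' : (2 : ℝ) ≤ colorDegree G c w (c w) := by exact_mod_cast h
    split_ifs <;> linarith

theorem colorDegree_le_conflictDegree (c : ColorAssignment G) (v : V) :
    (colorDegree G c v (c v) : ℝ) ≤ conflictDegree G c v := by
  rw [colorDegree_eq_sum, conflictDegree_eq_sum]
  refine Finset.sum_le_sum fun w _ => ?_
  by_cases h : G.Adj v w ∧ c w = c v
  · rw [if_pos h, if_pos]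
    refine ⟨h.1, ?_⟩
    simp only [conflicted, Finset.mem_filter, Finset.mem_univ, true_and]
    exact ⟨v, h.1.symm, h.2.symm⟩
  · rw [if_neg h]; split_ifs <;> norm_num

/-- Each quiet neighbor of the recolored vertex becomes conflicted for exactly one color, each leaf
is released by k − 1 colors, and the vertex itself is released by each of its free colors. There are
at least 2U − M leaves, and the conflict degrees of conflicted vertices add up to at least M. -/
theorem stepSum_conflictCount_le (c : ColorAssignment G) :
    stepSum G (conflictCount G) c ≤
      ∑ v ∈ conflicted G c, (G.degree v : ℝ) - monoSum G c -
        (palette G - 1) * (2 * conflictCount G c - monoSum G c) - freeSum G c := by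
  have h1 : ∀ v ∈ conflicted G c,
      ∑ x, (conflictCount G (Function.update c v x) - conflictCount G c) ≤
        ((G.degree v : ℝ) - conflictDegree G c v) -
          (palette G - 1) * (∑ w, if IsLeafOf c v w then (1 : ℝ) else 0) - freeCount G c v := by
    intro v hv
    have : ∀ x, conflictCount G (Function.update c v x) - conflictCount G c ≤
        (∑ w, if G.Adj v w ∧ c w = x ∧ w ∉ conflicted G c then (1 : ℝ) else 0) -
        (∑ w, if x ≠ c v ∧ IsLeafOf c v w then (1 : ℝ) else 0) -
        (if colorDegree G c v x = 0 then 1 else 0) := by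
      intro x
      have := Finset.sum_le_sum fun w (_ : w ∈ Finset.univ) => conflicted_update_le c v w x hv
      simp only [Finset.sum_sub_distrib] at this
      refine this.trans (le_of_eq ?_)
      congr 1
      simp only [ite_and]
      simp
    refine (Finset.sum_le_sum fun x _ => this x).trans (le_of_eq ?_)
    rw [Finset.sum_sub_distrib, Finset.sum_sub_distrib, ← freeCount_eq_sum, Finset.sum_comm]
    congr 2
    · rw [degree_eq_sum, conflictDegree_eq_sum, ← Finset.sum_sub_distrib]
      refine Finset.sum_congr rfl fun w _ => ?_
      by_cases h : G.Adj v w <;> by_cases h' : w ∈ conflicted G c <;> simp [h, h']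
    · rw [Finset.sum_comm, Finset.mul_sum]
      refine Finset.sum_congr rfl fun w _ => ?_
      have e : ∀ x, (if x ≠ c v ∧ IsLeafOf c v w then (1 : ℝ) else 0) =
          (if x ≠ c v then 1 else 0) * if IsLeafOf c v w then 1 else 0 := by
        intro x; grind
      simp_rw [e]
      rw [← Finset.sum_mul, sum_color_ne]
  refine (Finset.sum_le_sum h1).trans ?_
  rw [Finset.sum_sub_distrib, Finset.sum_sub_distrib, Finset.sum_sub_distrib, ← Finset.mul_sum,
    sum_leaves, sum_conflicted c (fun v => (freeCount G c v : ℝ)), ← freeSum]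
  have h2 : monoSum G c ≤ ∑ v ∈ conflicted G c, (conflictDegree G c v : ℝ) := by
    rw [← sum_conflicted_monoSum]
    exact Finset.sum_le_sum fun v _ => colorDegree_le_conflictDegree c v
  have h3 := two_mul_conflictCount_le c
  have h4 := one_le_palette (G := G)
  nlinarith

theorem conflictCount_le_monoSum (c : ColorAssignment G) : conflictCount G c ≤ monoSum G c := by
  refine Finset.sum_le_sum fun w _ => ?_
  simp only [mem_conflicted_iff]
  split_ifs with h
  · exact_mod_cast Nat.one_le_iff_ne_zero.2 h
  · positivity

theorem stepSum_mono_add_conflict_le (c : ColorAssignment G) :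
    stepSum G (monoSum G) c + stepSum G (conflictCount G) c ≤
      -freeSum G c - palette G * (monoSum G c - conflictCount G c) := by
  have h1 := stepSum_conflictCount_le c
  have h2 := stepSum_monoSum c
  have h3 := sum_degree_conflicted_le c
  have h4 := one_le_palette (G := G)
  have h5 := conflictCount_nonneg c
  have h6 : 0 ≤ monoSum G c := Finset.sum_nonneg fun _ _ => by positivity
  have h7 := conflictCount_le_monoSum c
  nlinarith

/-- A newly conflicted vertex enters the sum with all its free colors except possibly the one just
used up. The losses are bounded crudely: departing leaves and `v` are charged in full, and surviving
conflicted neighbors are charged one color. -/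
theorem freeSum_update_term (c : ColorAssignment G) (v y : V) (x : Color G) :
    (if G.Adj v y ∧ c y = x ∧ y ∉ conflicted G c then (freeCount G c y : ℝ) - 1 else 0) -
        (if IsLeafOf c v y then (freeCount G c y : ℝ) else 0) -
        (if y ∈ conflicted G c ∧ G.Adj v y ∧ colorDegree G c y x = 0 then 1 else 0) -
        (if y = v then (freeCount G c y : ℝ) else 0) ≤
      (if y ∈ conflicted G (Function.update c v x) then
          (freeCount G (Function.update c v x) y : ℝ) else 0) -
        (if y ∈ conflicted G c then (freeCount G c y : ℝ) else 0) := by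
  have h1 := le_freeCount_update c v y x
  have h2 := one_le_freeCount c y
  have h3 := one_le_freeCount (Function.update c v x) y
  have h4 := leaves_of_not_mem_conflicted_update c v y x
  have h5 := G.adj_comm v y
  by_cases hn : G.Adj v y ∧ c y = x ∧ y ∉ conflicted G c
  · obtain ⟨ha, rfl, hu⟩ := hn
    have h6 := mem_conflicted_update_of_adj c v y ha
    have h7 := ha.ne'
    grind
  · rw [if_neg hn]
    by_cases hu : y ∈ conflicted G c <;> by_cases hu' : y ∈ conflicted G (Function.update c v x)
    · simp only [hu, hu', if_true]
      grind
    · simp only [hu, hu', if_true, if_false]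
      grind
    · simp only [hu, hu', if_true, if_false]
      grind
    · simp only [hu, hu', if_false]
      grind

/-- A quiet vertex enters the sum once per conflicted neighbor, when that neighbor copies its color.
This yields the main term. The five units of kF pay for the leaves, the recolored vertices, the
correction −1 per newly conflicted vertex, and two for the vertices that were already conflicted. -/
theorem le_stepSum_freeSum (c : ColorAssignment G) :
    neighborFreeSum G c - 5 * palette G * freeSum G c ≤ stepSum G (freeSum G) c := by
  have hk := one_le_palette (G := G)
  have h1 : ∀ v ∈ conflicted G c,
      (∑ y, if G.Adj v y then
          (if y ∈ conflicted G c then 0 else (freeCount G c y : ℝ) - 1) else 0) -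
        palette G * (∑ y, if IsLeafOf c v y then (freeCount G c y : ℝ) else 0) -
        (∑ y, if G.Adj v y then
          (if y ∈ conflicted G c then (freeCount G c y : ℝ) else 0) else 0) -
        palette G * freeCount G c v ≤
      ∑ x, (freeSum G (Function.update c v x) - freeSum G c) := by
    intro v _
    have := Finset.sum_le_sum fun x (_ : x ∈ Finset.univ) =>
      Finset.sum_le_sum fun y (_ : y ∈ Finset.univ) => freeSum_update_term c v y x
    simp only [Finset.sum_sub_distrib] at this
    simp only [Finset.sum_sub_distrib, freeSum]
    refine le_trans (le_of_eq ?_) this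
    congr 1
    · congr 1
      · congr 1
        · rw [Finset.sum_comm]
          refine Finset.sum_congr rfl fun y _ => ?_
          by_cases h : G.Adj v y <;> by_cases h' : y ∈ conflicted G c <;> simp [h, h']
        · rw [sum_color_const]
      · rw [Finset.sum_comm]
        refine Finset.sum_congr rfl fun y _ => ?_
        rw [freeCount_eq_sum]
        by_cases h : G.Adj v y <;> by_cases h' : y ∈ conflicted G c <;> simp [h, h']
    · rw [sum_color_const]; simp
  refine le_trans ?_ (Finset.sum_le_sum h1)
  simp only [Finset.sum_sub_distrib, ← Finset.mul_sum]
  rw [sum_conflicted_neighbors, sum_conflicted_neighbors,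
    sum_conflicted c (fun v => (freeCount G c v : ℝ))]
  have h2 := sum_leaves_le c (fun v => (freeCount G c v : ℝ)) (fun v => by positivity)
  rw [← freeSum] at h2 ⊢
  have h3 : neighborFreeSum G c - ∑ v, (conflictDegree G c v : ℝ) - 2 * palette G * freeSum G c ≤
      (∑ w, (conflictDegree G c w : ℝ) *
        (if w ∈ conflicted G c then 0 else (freeCount G c w : ℝ) - 1)) -
      ∑ w, (conflictDegree G c w : ℝ) *
        (if w ∈ conflicted G c then (freeCount G c w : ℝ) else 0) := by
    rw [neighborFreeSum, freeSum, Finset.mul_sum, ← Finset.sum_sub_distrib,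
      ← Finset.sum_sub_distrib, ← Finset.sum_sub_distrib]
    refine Finset.sum_le_sum fun w _ => ?_
    have a1 := conflictDegree_le c w
    have a2 := one_le_freeCount c w
    have a3 : (0 : ℝ) ≤ conflictDegree G c w := by positivity
    split_ifs <;> nlinarith
  rw [sum_conflictDegree] at h3
  have h4 := sum_degree_conflicted_le c
  have h5 := conflictCount_le_freeSum c
  have h6 := conflictCount_nonneg c
  nlinarith

theorem le_conflictDegree_update (c : ColorAssignment G) (v u : V) (x : Color G) :
    (conflictDegree G c u : ℝ) - (∑ w, if G.Adj u w then
        ((if IsLeafOf c v w then (1 : ℝ) else 0) + if w = v then 1 else 0) else 0) ≤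
      conflictDegree G (Function.update c v x) u := by
  rw [conflictDegree_eq_sum, conflictDegree_eq_sum, ← Finset.sum_sub_distrib]
  refine Finset.sum_le_sum fun w _ => ?_
  have h4 := leaves_of_not_mem_conflicted_update c v w x
  grind

theorem neighborFreeSum_update_term (c : ColorAssignment G) (v u : V) (x : Color G) :
    ((if G.Adj v u ∧ colorDegree G c u (c v) = 1 ∧ x ≠ c v then (1 : ℝ) else 0) -
        (if G.Adj v u ∧ colorDegree G c u x = 0 then 1 else 0)) * conflictDegree G c u -
      2 * freeCount G c u * (∑ w, if G.Adj u w then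
        ((if IsLeafOf c v w then (1 : ℝ) else 0) + if w = v then 1 else 0) else 0) ≤
    (freeCount G (Function.update c v x) u : ℝ) * conflictDegree G (Function.update c v x) u -
      freeCount G c u * conflictDegree G c u := by
  set L := ∑ w, if G.Adj u w then
        ((if IsLeafOf c v w then (1 : ℝ) else 0) + if w = v then 1 else 0) else 0
  have h1 := le_freeCount_update c v u x
  have h2 := one_le_freeCount c u
  have h3 := one_le_freeCount (Function.update c v x) u
  have h4 := freeCount_update_le c v u x
  have h5 : (conflictDegree G c u : ℝ) - L ≤ _ := le_conflictDegree_update c v u x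
  have h0 : 0 ≤ L := Finset.sum_nonneg fun w _ => by split_ifs <;> norm_num
  -- One step frees at most one color of `u`, and `u` always has a free color, so the count at most
  -- doubles.
  have h6 : (freeCount G (Function.update c v x) u : ℝ) ≤ 2 * freeCount G c u := by
    split_ifs at h4 <;> linarith
  simp only [G.adj_comm u v] at h1
  have h7 : (0 : ℝ) ≤ conflictDegree G c u := by positivity
  have h8 := mul_le_mul_of_nonneg_right h1 h7
  have h9 := mul_le_mul_of_nonneg_left h5
    (by linarith : (0 : ℝ) ≤ freeCount G (Function.update c v x) u)
  have h10 := mul_le_mul_of_nonneg_right h6 h0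
  linarith

/-- Let f be the number of free colors of `u` and d its number of conflicted neighbors. All but 2f
of the latter carry a color unique around `u`, and recoloring one of those with any of k − 1 other
colors frees a color. The gain is (k − 1)(d − 2f)d; the losses are 2kfd from repeated colors, kfd
from used-up free colors and 4kfd from neighbors that stop being conflicted. -/
theorem le_stepSum_neighborFreeSum (c : ColorAssignment G) :
    palette G / 2 * ∑ v, (conflictDegree G c v : ℝ) ^ 2 - 7 * palette G * neighborFreeSum G c ≤
      stepSum G (neighborFreeSum G) c := by
  have hk := one_le_palette (G := G)
  set k := palette G with hkdef
  have h1 : stepSum G (neighborFreeSum G) c = ∑ u, ∑ v ∈ conflicted G c, ∑ x,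
      ((freeCount G (Function.update c v x) u : ℝ) * conflictDegree G (Function.update c v x) u -
      freeCount G c u * conflictDegree G c u) := by
    simp only [stepSum, neighborFreeSum, ← Finset.sum_sub_distrib]
    symm
    rw [Finset.sum_comm]
    exact Finset.sum_congr rfl fun v _ => Finset.sum_comm
  have h2 : ∀ u, ∀ v ∈ conflicted G c,
      ((if G.Adj v u then (if colorDegree G c u (c v) = 1 then k - 1 else 0) - freeCount G c u
          else 0) * conflictDegree G c u) -
        k * (2 * freeCount G c u * (∑ w, if G.Adj u w then
          ((if IsLeafOf c v w then (1 : ℝ) else 0) + if w = v then 1 else 0) else 0)) ≤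
      ∑ x, ((freeCount G (Function.update c v x) u : ℝ) *
        conflictDegree G (Function.update c v x) u - freeCount G c u * conflictDegree G c u) := by
    intro u v _
    refine le_trans (le_of_eq ?_)
      (Finset.sum_le_sum fun x _ => neighborFreeSum_update_term c v u x)
    rw [Finset.sum_sub_distrib, sum_color_const, ← Finset.sum_mul, Finset.sum_sub_distrib]
    congr 2
    have h4 := sum_color_ne (c v)
    rw [← hkdef] at h4
    rw [← h4, freeCount_eq_sum]
    by_cases ha : G.Adj v u <;> by_cases hd : colorDegree G c u (c v) = 1 <;> simp [ha, hd]
  rw [h1, neighborFreeSum, Finset.mul_sum, Finset.mul_sum, ← Finset.sum_sub_distrib]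
  refine Finset.sum_le_sum fun u _ => ?_
  refine le_trans ?_ (Finset.sum_le_sum (h2 u))
  rw [Finset.sum_sub_distrib, ← Finset.sum_mul, ← Finset.mul_sum, ← Finset.mul_sum]
  -- A conflicted neighbor of `u` is charged at most twice in total: once when it is recolored
  -- itself, and at most once as a leaf.
  have h5 : ∑ v ∈ conflicted G c, (∑ w, if G.Adj u w then
      ((if IsLeafOf c v w then (1 : ℝ) else 0) + if w = v then 1 else 0) else 0) ≤
      2 * conflictDegree G c u := by
    have e : ∀ v w, (if G.Adj u w then
      ((if IsLeafOf c v w then (1 : ℝ) else 0) + if w = v then 1 else 0) else 0) =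
      (if IsLeafOf c v w then (if G.Adj u w then (1 : ℝ) else 0) else 0) +
        if w = v then (if G.Adj u v then 1 else 0) else 0 := by
      intro v w
      grind
    simp_rw [e, Finset.sum_add_distrib]
    have l := sum_leaves_le c (fun w => if G.Adj u w then (1 : ℝ) else 0)
      (fun w => by split_ifs <;> norm_num)
    have r : ∑ w, (if w ∈ conflicted G c then (if G.Adj u w then (1 : ℝ) else 0) else 0) =
        conflictDegree G c u := by
      rw [conflictDegree_eq_sum]
      refine Finset.sum_congr rfl fun w _ => ?_
      grind
    simp only [Finset.sum_ite_eq', Finset.mem_univ, if_true]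
    rw [sum_conflicted c (fun w => if G.Adj u w then (1 : ℝ) else 0)]
    linarith
  have h6 : (k - 1) * (conflictDegree G c u - 2 * freeCount G c u) -
      freeCount G c u * conflictDegree G c u ≤ ∑ v ∈ conflicted G c, if G.Adj v u then
        (if colorDegree G c u (c v) = 1 then k - 1 else 0) - (freeCount G c u : ℝ) else 0 := by
    have e : ∀ v, (if G.Adj v u then (if colorDegree G c u (c v) = 1 then k - 1 else 0) -
        (freeCount G c u : ℝ) else 0) = (k - 1 - freeCount G c u) *
          (if G.Adj u v then 1 else 0) - (k - 1) *
          (if G.Adj u v then (if colorDegree G c u (c v) = 1 then 0 else 1) else 0) := by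
      intro v
      have := G.adj_comm v u
      grind
    simp_rw [e, Finset.sum_sub_distrib, ← Finset.mul_sum]
    have r1 : ∑ v ∈ conflicted G c, (if G.Adj u v then
        (if colorDegree G c u (c v) = 1 then (0 : ℝ) else 1) else 0) ≤ 2 * freeCount G c u :=
      (Finset.sum_le_sum_of_subset_of_nonneg (Finset.subset_univ _) fun v _ _ => by
        split_ifs <;> norm_num).trans (card_repeated_le c u)
    have r2 : ∑ v ∈ conflicted G c, (if G.Adj u v then (1 : ℝ) else 0) =
        conflictDegree G c u := by
      rw [conflictDegree_eq_sum, sum_conflicted c (fun v => if G.Adj u v then (1 : ℝ) else 0)]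
      refine Finset.sum_congr rfl fun w _ => ?_
      grind
    rw [r2]
    have := mul_le_mul_of_nonneg_left r1 (by linarith : 0 ≤ k - 1)
    linarith
  have a0 : (0 : ℝ) ≤ conflictDegree G c u := by positivity
  have a1 := conflictDegree_le c u
  have a2 := one_le_freeCount c u
  have h7 := mul_le_mul_of_nonneg_right h6 a0
  have h8 := mul_le_mul_of_nonneg_left h5 (by positivity : 0 ≤ k * (2 * (freeCount G c u : ℝ)))
  -- If `u` has a conflicted neighbor then Δ ≥ 1, so k ≥ 2 and k/2 ≤ k − 1.
  have h9 : k / 2 * (conflictDegree G c u : ℝ) ^ 2 ≤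
      (k - 1) * (conflictDegree G c u : ℝ) ^ 2 := by
    rcases Nat.eq_zero_or_pos (conflictDegree G c u) with h | h
    · simp [h]
    · have b1 : (1 : ℝ) ≤ conflictDegree G c u := by exact_mod_cast h
      have b2 := conflictDegree_le_degree c u
      have b3 := degree_add_one_le (G := G) u
      gcongr
      linarith
  have p1 : 0 ≤ (freeCount G c u : ℝ) * conflictDegree G c u := by positivity
  have p2 : (freeCount G c u : ℝ) * conflictDegree G c u * conflictDegree G c u ≤
      k * ((freeCount G c u : ℝ) * conflictDegree G c u) := by
    rw [mul_comm k]
    exact mul_le_mul_of_nonneg_left a1 p1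
  nlinarith

end

/-! ### The potential: size, drift and bounded increments -/

section
variable {V : Type*} [Fintype V] [DecidableEq V] (G : SimpleGraph V) [DecidableRel G.Adj]

/-- A potential whose expected decrease in a recoloring step is at least proportional to it. -/
noncomputable def potential (c : ColorAssignment G) : ℝ :=
  monoSum G c + conflictCount G c - freeSum G c / (10 * palette G) -
    neighborFreeSum G c / (70 * palette G ^ 2)

variable {G}

theorem freeSum_nonneg (c : ColorAssignment G) : 0 ≤ freeSum G c :=
  (conflictCount_nonneg c).trans (conflictCount_le_freeSum c)

theorem neighborFreeSum_nonneg (c : ColorAssignment G) : 0 ≤ neighborFreeSum G c :=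
  Finset.sum_nonneg fun _ _ => by positivity

theorem potential_le (c : ColorAssignment G) :
    potential G c ≤ monoSum G c + conflictCount G c := by
  have := one_le_palette (G := G)
  have h1 : 0 ≤ freeSum G c / (10 * palette G) :=
    div_nonneg (freeSum_nonneg c) (by positivity)
  have h2 : 0 ≤ neighborFreeSum G c / (70 * palette G ^ 2) :=
    div_nonneg (neighborFreeSum_nonneg c) (by positivity)
  rw [potential]; linarith

/-- The subtracted terms are at most U/10 and U/70, since F ≤ kU and N ≤ k²U. -/
theorem potential_nonneg (c : ColorAssignment G) : 0 ≤ potential G c := by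
  have := one_le_palette (G := G)
  have h1 : freeSum G c / (10 * palette G) ≤ conflictCount G c / 10 := by
    rw [div_le_iff₀ (by positivity)]
    linarith [freeSum_le c]
  have h2 : neighborFreeSum G c / (70 * palette G ^ 2) ≤ conflictCount G c / 70 := by
    rw [div_le_iff₀ (by positivity)]
    linarith [neighborFreeSum_le c]
  have h3 := conflictCount_nonneg c
  have h4 := conflictCount_le_monoSum c
  rw [potential]; linarith

theorem conflictCount_le_card (c : ColorAssignment G) : conflictCount G c ≤ Fintype.card V := by
  rw [conflictCount_eq_card]
  exact_mod_cast Finset.card_le_univ _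

theorem potential_le_card (c : ColorAssignment G) :
    potential G c ≤ palette G * Fintype.card V := by
  have h : monoSum G c ≤ ∑ _v : V, (palette G - 1) :=
    Finset.sum_le_sum fun v _ => by linarith [colorDegree_le c v (c v)]
  rw [Finset.sum_const, Finset.card_univ, nsmul_eq_mul] at h
  linarith [potential_le c, conflictCount_le_card c]

/-- The weights make the errors telescope: the loss 5kF weighted by 1/(10k) is half of the available
−F, and the loss 7kN weighted by 1/(70k²) cancels the gain N/(10k) exactly. -/
theorem stepSum_potential_le (c : ColorAssignment G) :
    stepSum G (potential G) c ≤ -(freeSum G c / 2) -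
      palette G * (monoSum G c - conflictCount G c) -
      (∑ v, (conflictDegree G c v : ℝ) ^ 2) / (140 * palette G) := by
  have hk := one_le_palette (G := G)
  set k := palette G with hkdef
  have h : stepSum G (potential G) c = stepSum G (monoSum G) c + stepSum G (conflictCount G) c -
      stepSum G (freeSum G) c / (10 * k) - stepSum G (neighborFreeSum G) c / (70 * k ^ 2) := by
    simp only [stepSum, Finset.sum_div, ← Finset.sum_add_distrib, ← Finset.sum_sub_distrib]
    refine Finset.sum_congr rfl fun v _ => Finset.sum_congr rfl fun x _ => ?_
    simp only [potential]
    ring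
  have h1 := stepSum_mono_add_conflict_le c
  have h2 : neighborFreeSum G c / (10 * k) - freeSum G c / 2 ≤
      stepSum G (freeSum G) c / (10 * k) := by
    rw [le_div_iff₀ (by positivity), sub_mul, div_mul_cancel₀ _ (by positivity)]
    linarith [le_stepSum_freeSum c]
  have h3 : (∑ v, (conflictDegree G c v : ℝ) ^ 2) / (140 * k) - neighborFreeSum G c / (10 * k) ≤
      stepSum G (neighborFreeSum G) c / (70 * k ^ 2) := by
    rw [le_div_iff₀ (by positivity), sub_mul]
    have e1 : (∑ v, (conflictDegree G c v : ℝ) ^ 2) / (140 * k) * (70 * k ^ 2) =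
        k / 2 * ∑ v, (conflictDegree G c v : ℝ) ^ 2 := by
      field_simp; ring
    have e2 : neighborFreeSum G c / (10 * k) * (70 * k ^ 2) = 7 * k * neighborFreeSum G c := by
      field_simp; ring
    rw [e1, e2]
    exact le_stepSum_neighborFreeSum c
  rw [h]
  linarith

theorem stepSum_potential_le_neg_conflictCount (c : ColorAssignment G) :
    stepSum G (potential G) c ≤ -(conflictCount G c / 2) := by
  have hk := one_le_palette (G := G)
  have h1 := stepSum_potential_le c
  have h2 := conflictCount_le_freeSum c
  have h3 := conflictCount_le_monoSum c
  have h4 : 0 ≤ palette G * (monoSum G c - conflictCount G c) :=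
    mul_nonneg (by linarith) (by linarith)
  have h5 : 0 ≤ (∑ v, (conflictDegree G c v : ℝ) ^ 2) / (140 * palette G) := by positivity
  linarith

theorem stepSum_potential_le_neg_potential (c : ColorAssignment G) :
    stepSum G (potential G) c ≤ -(palette G * conflictCount G c *
      (potential G c / (1120 * Fintype.card V))) := by
  have hk := one_le_palette (G := G)
  have h1 := stepSum_potential_le c
  have h3 := conflictCount_le_monoSum c
  have hu := conflictCount_nonneg c
  have hun := conflictCount_le_card c
  have hp := potential_le c
  set k := palette G
  set u := conflictCount G c with hudef
  set n : ℝ := (Fintype.card V : ℝ) with hndef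
  set W := monoSum G c - u with hW
  set a := ∑ v ∈ conflicted G c, (G.degree v : ℝ) with hadef
  have ha : 0 ≤ a := Finset.sum_nonneg fun _ _ => by positivity
  -- Every color is free at a vertex or used by one of its neighbors, so a vertex has at least k −
  -- deg free colors.
  have hG : k * u - a ≤ freeSum G c := by
    rw [hudef, conflictCount_eq_card, hadef, mul_comm, ← nsmul_eq_mul, ← Finset.sum_const,
      ← Finset.sum_sub_distrib, freeSum, ← sum_conflicted c (fun v => (freeCount G c v : ℝ))]
    exact Finset.sum_le_sum fun v _ => by linarith [palette_le_degree_add_freeCount c v]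
  rcases hu.eq_or_lt with h0 | hupos
  · rw [← h0]
    have := stepSum_potential_le_neg_conflictCount c
    rw [← hudef, ← h0] at this
    simpa using this
  have hn : 0 < n := hupos.trans_le hun
  set B := ∑ v, (conflictDegree G c v : ℝ) ^ 2 with hB
  have hB2 : a ^ 2 ≤ n * B := by
    rw [hadef, ← sum_conflictDegree]
    exact sq_sum_le_card_mul_sum_sq
  have hB0 : 0 ≤ B := by positivity
  -- If the degree sum a is at least ku/2, Cauchy–Schwarz gives B ≥ a²/n ≥ k²u²/(4n). Otherwise at
  -- least ku/2 free colors are available, and u ≤ n finishes.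
  have hbase : k * u ^ 2 / (560 * n) ≤ freeSum G c / 2 + B / (140 * k) := by
    rcases le_total (k * u / 2) a with hc | hc
    · have s1 : (k * u / 2) ^ 2 ≤ n * B :=
        (pow_le_pow_left₀ (by positivity) hc 2).trans hB2
      have s2 : k * u ^ 2 / (560 * n) ≤ B / (140 * k) := by
        rw [div_le_div_iff₀ (by positivity) (by positivity)]
        nlinarith
      linarith [freeSum_nonneg c]
    · have s1 : k * u ^ 2 / (560 * n) ≤ k * u / 4 := by
        rw [div_le_div_iff₀ (by positivity) (by positivity)]
        have : k * u * u ≤ k * u * n := mul_le_mul_of_nonneg_left hun (by positivity)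
        nlinarith [mul_nonneg (mul_nonneg (by linarith : 0 ≤ k) hu) hn.le]
      have s2 : 0 ≤ B / (140 * k) := by positivity
      linarith
  have hW0 : 0 ≤ W := by linarith
  have s3 : k * u * (potential G c / (1120 * n)) ≤ k * u * ((W + 2 * u) / (1120 * n)) := by
    gcongr
    linarith
  have s4 : k * u * ((W + 2 * u) / (1120 * n)) = k * u ^ 2 / (560 * n) +
      k * W * (u / (1120 * n)) := by
    field_simp; ring
  have s5 : k * W * (u / (1120 * n)) ≤ k * W * 1 := by
    gcongr
    rw [div_le_one (by positivity)]
    linarith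
  linarith

theorem abs_conflict_update_sub_le (c : ColorAssignment G) (v w : V) (x : Color G) :
    |(if w ∈ conflicted G (Function.update c v x) then (1 : ℝ) else 0) -
        (if w ∈ conflicted G c then 1 else 0)| ≤
      (if G.Adj v w then 1 else 0) + if w = v then 1 else 0 := by
  have h1 := leaves_of_not_mem_conflicted_update c v w x
  have h2 := adj_of_mem_conflicted_update c v w x
  by_cases hu : w ∈ conflicted G c <;>
    by_cases hu' : w ∈ conflicted G (Function.update c v x) <;>
    simp only [hu, hu', if_true, if_false] <;> grind

theorem abs_freeCount_update_sub_le (c : ColorAssignment G) (v w : V) (x : Color G) :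
    |(freeCount G (Function.update c v x) w : ℝ) - freeCount G c w| ≤
      if G.Adj v w then 1 else 0 := by
  have h1 := freeCount_update_le c v w x
  have h2 := le_freeCount_update c v w x
  have h3 := G.adj_comm v w
  rw [abs_le]
  grind

theorem sum_closed_neighborhood (v : V) (a : ℝ) :
    ∑ w, ((if G.Adj v w then (1 : ℝ) else 0) + if w = v then 1 else 0) * a =
      (G.degree v + 1) * a := by
  rw [← Finset.sum_mul, Finset.sum_add_distrib, ← degree_eq_sum]
  simp

theorem abs_monoSum_update_sub_le (c : ColorAssignment G) (v : V) (x : Color G) :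
    |monoSum G (Function.update c v x) - monoSum G c| ≤ 2 * palette G := by
  rw [monoSum_update, abs_le]
  have h1 := colorDegree_le c v x
  have h2 := colorDegree_le c v (c v)
  have h3 : (0 : ℝ) ≤ colorDegree G c v x := by positivity
  have h4 : (0 : ℝ) ≤ colorDegree G c v (c v) := by positivity
  constructor <;> linarith

theorem abs_conflictCount_update_sub_le (c : ColorAssignment G) (v : V) (x : Color G) :
    |conflictCount G (Function.update c v x) - conflictCount G c| ≤ palette G := by
  rw [conflictCount, conflictCount, ← Finset.sum_sub_distrib]
  refine (Finset.abs_sum_le_sum_abs _ _).trans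
    ((Finset.sum_le_sum fun w _ => abs_conflict_update_sub_le c v w x).trans ?_)
  have := sum_closed_neighborhood (G := G) v 1
  simp only [mul_one] at this
  rw [this]
  exact degree_add_one_le v

theorem abs_mul_sub_mul_le {a b a' b' r s A B : ℝ} (ha : |a' - a| ≤ r) (hb : |b' - b| ≤ s)
    (h0 : 0 ≤ a') (h1 : a' ≤ A) (h2 : 0 ≤ b) (h3 : b ≤ B) :
    |a' * b' - a * b| ≤ A * s + r * B := by
  have e : a' * b' - a * b = a' * (b' - b) + (a' - a) * b := by ring
  rw [e]
  refine (abs_add_le _ _).trans ?_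
  rw [abs_mul, abs_mul, abs_of_nonneg h0, abs_of_nonneg h2]
  have hs : 0 ≤ s := (abs_nonneg _).trans hb
  have hr : 0 ≤ r := (abs_nonneg _).trans ha
  have hA : 0 ≤ A := h0.trans h1
  gcongr

theorem abs_freeSum_update_sub_le (c : ColorAssignment G) (v : V) (x : Color G) :
    |freeSum G (Function.update c v x) - freeSum G c| ≤ 2 * palette G ^ 2 := by
  have hk := one_le_palette (G := G)
  have key : ∀ w, |(freeCount G (Function.update c v x) w : ℝ) *
      (if w ∈ conflicted G (Function.update c v x) then (1 : ℝ) else 0) -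
      freeCount G c w * (if w ∈ conflicted G c then (1 : ℝ) else 0)| ≤
      ((if G.Adj v w then (1 : ℝ) else 0) + if w = v then 1 else 0) * (2 * palette G) := by
    intro w
    have h := abs_mul_sub_mul_le (abs_freeCount_update_sub_le c v w x)
      (abs_conflict_update_sub_le c v w x) (by positivity) (freeCount_le _ w)
      (by split_ifs <;> norm_num) (B := 1) (by split_ifs <;> norm_num)
    refine h.trans ?_
    split_ifs <;> linarith
  have e : ∀ c : ColorAssignment G, freeSum G c =
      ∑ w, (freeCount G c w : ℝ) * (if w ∈ conflicted G c then (1 : ℝ) else 0) := by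
    intro c; simp [freeSum]
  rw [e, e, ← Finset.sum_sub_distrib]
  refine (Finset.abs_sum_le_sum_abs _ _).trans ((Finset.sum_le_sum fun w _ => key w).trans ?_)
  rw [sum_closed_neighborhood]
  nlinarith [degree_add_one_le (G := G) v]

/-- Conflict status changes only in the closed neighborhood of `v`, at most k vertices, each seen by
fewer than k others with at most k free colors: k³. Free counts change by at most 1 at neighbors of
`v`, each weighted by at most k: k² ≤ k³. -/
theorem abs_neighborFreeSum_update_sub_le (c : ColorAssignment G) (v : V) (x : Color G) :
    |neighborFreeSum G (Function.update c v x) - neighborFreeSum G c| ≤ 2 * palette G ^ 3 := by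
  have hk := one_le_palette (G := G)
  have hb : ∀ u, |(conflictDegree G (Function.update c v x) u : ℝ) - conflictDegree G c u| ≤
      ∑ w, if G.Adj u w then
        ((if G.Adj v w then (1 : ℝ) else 0) + if w = v then 1 else 0) else 0 := by
    intro u
    rw [conflictDegree_eq_sum, conflictDegree_eq_sum, ← Finset.sum_sub_distrib]
    refine (Finset.abs_sum_le_sum_abs _ _).trans (Finset.sum_le_sum fun w _ => ?_)
    have := abs_conflict_update_sub_le c v w x
    by_cases h : G.Adj u w
    · simpa [h] using this
    · simp [h]
  have key := fun u => abs_mul_sub_mul_le (abs_freeCount_update_sub_le c v u x) (hb u)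
    (by positivity) (freeCount_le _ u) (by positivity) (conflictDegree_le c u)
  rw [neighborFreeSum, neighborFreeSum, ← Finset.sum_sub_distrib]
  refine (Finset.abs_sum_le_sum_abs _ _).trans ((Finset.sum_le_sum fun w _ => key w).trans ?_)
  rw [Finset.sum_add_distrib, ← Finset.mul_sum, ← Finset.sum_mul, ← degree_eq_sum,
    Finset.sum_comm]
  have h1 : ∀ w, (∑ u, if G.Adj u w then
      ((if G.Adj v w then (1 : ℝ) else 0) + if w = v then 1 else 0) else 0) ≤
      ((if G.Adj v w then (1 : ℝ) else 0) + if w = v then 1 else 0) * palette G := by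
    intro w
    have e : ∀ u, (if G.Adj u w then
        ((if G.Adj v w then (1 : ℝ) else 0) + if w = v then 1 else 0) else 0) =
        ((if G.Adj v w then (1 : ℝ) else 0) + if w = v then 1 else 0) *
          if G.Adj w u then 1 else 0 := by
      intro u
      have := G.adj_comm u w
      grind
    simp_rw [e]
    rw [← Finset.mul_sum, ← degree_eq_sum]
    refine mul_le_mul_of_nonneg_left ?_ (by split_ifs <;> norm_num)
    linarith [degree_add_one_le (G := G) w]
  have h2 := Finset.sum_le_sum fun w (_ : w ∈ Finset.univ) => h1 w
  rw [sum_closed_neighborhood] at h2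
  have h3 := degree_add_one_le (G := G) v
  have h4 : ((G.degree v : ℝ) + 1) * palette G ≤ palette G * palette G := by gcongr
  have h5 := mul_le_mul_of_nonneg_left (h2.trans h4) (by linarith : 0 ≤ palette G)
  have h6 : (G.degree v : ℝ) * palette G ≤ palette G * palette G := by
    gcongr; linarith
  nlinarith [mul_nonneg (by linarith : 0 ≤ palette G) (by linarith : 0 ≤ palette G)]

/-- The powers of k in the weights bring all four terms to order k: 2k + k + k/5 + k/35. -/
theorem abs_potential_update_sub_le (c : ColorAssignment G) (v : V) (x : Color G) :
    |potential G (Function.update c v x) - potential G c| ≤ 4 * palette G := by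
  have hk := one_le_palette (G := G)
  have h1 := abs_le.1 (abs_monoSum_update_sub_le c v x)
  have h2 := abs_le.1 (abs_conflictCount_update_sub_le c v x)
  have h3 : |freeSum G (Function.update c v x) / (10 * palette G) -
      freeSum G c / (10 * palette G)| ≤ palette G / 5 := by
    rw [← sub_div, abs_div, abs_of_pos (by positivity : 0 < 10 * palette G),
      div_le_iff₀ (by positivity)]
    refine (abs_freeSum_update_sub_le c v x).trans (le_of_eq (by ring))
  have h4 : |neighborFreeSum G (Function.update c v x) / (70 * palette G ^ 2) -
      neighborFreeSum G c / (70 * palette G ^ 2)| ≤ palette G / 35 := by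
    rw [← sub_div, abs_div, abs_of_pos (by positivity : 0 < 70 * palette G ^ 2),
      div_le_iff₀ (by positivity)]
    refine (abs_neighborFreeSum_update_sub_le c v x).trans (le_of_eq (by ring))
  have h3' := abs_le.1 h3
  have h4' := abs_le.1 h4
  rw [potential, potential, abs_le]
  constructor <;> linarith [h1.1, h1.2, h2.1, h2.2, h3'.1, h3'.2, h4'.1, h4'.2]

end

/-! ### Expectations along the run -/

section
variable {V : Type*} [Fintype V] [DecidableEq V] (G : SimpleGraph V) [DecidableRel G.Adj]

/-- The expectation of `h` at time `t` of the run. -/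
noncomputable def meanAt (t : ℕ) (h : ColorAssignment G → ℝ) : ℝ := ∫ c, h (c t) ∂run G

/-- The expectation of `h` after a recoloring step. -/
noncomputable def stepMean (h : ColorAssignment G → ℝ) (c : ColorAssignment G) : ℝ :=
  ∫ c', h c' ∂(step G c).toMeasure

/-- The indicator of the colorings that are not proper. -/
noncomputable def improper (c : ColorAssignment G) : ℝ :=
  if (conflicted G c).Nonempty then 1 else 0

variable {G}

theorem stepMean_of_not_nonempty (h : ColorAssignment G → ℝ) (c : ColorAssignment G)
    (hc : ¬ (conflicted G c).Nonempty) : stepMean G h c = h c := by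
  rw [stepMean, step, dif_neg hc, PMF.toMeasure_pure, integral_dirac]

theorem sum_bind_toReal_mul {α β : Type*} [Fintype α] [Fintype β] (p : PMF α) (q : α → PMF β)
    (f : β → ℝ) :
    ∑ b, ((p.bind q) b).toReal * f b = ∑ a, (p a).toReal * ∑ b, (q a b).toReal * f b := by
  simp_rw [PMF.bind_apply, tsum_fintype]
  have : ∀ b, (∑ a, p a * q a b).toReal = ∑ a, (p a).toReal * (q a b).toReal := by
    intro b
    rw [ENNReal.toReal_sum fun a _ => ENNReal.mul_ne_top (p.apply_ne_top a)
      ((q a).apply_ne_top b)]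
    simp_rw [ENNReal.toReal_mul]
  simp_rw [this, Finset.sum_mul, Finset.mul_sum]
  rw [Finset.sum_comm]
  simp_rw [mul_assoc]

theorem stepMean_of_nonempty (h : ColorAssignment G → ℝ) (c : ColorAssignment G)
    (hc : (conflicted G c).Nonempty) :
    stepMean G h c = (∑ v ∈ conflicted G c, ∑ x, h (Function.update c v x)) /
      (palette G * conflictCount G c) := by
  rw [stepMean, PMF.integral_eq_sum, step, dif_pos hc]
  simp only [smul_eq_mul]
  rw [sum_bind_toReal_mul]
  have hm : ∀ v, ∑ b, (((PMF.uniformOfFintype (Color G)).map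
      fun x => Function.update c v x) b).toReal * h b =
      (∑ x, h (Function.update c v x)) / palette G := by
    intro v
    rw [PMF.map, sum_bind_toReal_mul, Finset.sum_div]
    refine Finset.sum_congr rfl fun x _ => ?_
    rw [PMF.uniformOfFintype_apply, ENNReal.toReal_inv, ENNReal.toReal_natCast,
      ← palette_eq_card, div_eq_inv_mul]
    congr 1
    simp only [Function.comp_apply, PMF.pure_apply]
    rw [Finset.sum_eq_single (Function.update c v x)]
    · simp
    · intro b _ hb'; simp [hb']
    · simp
  simp_rw [hm, PMF.uniformOfFinset_apply]
  rw [div_mul_eq_div_div, conflictCount_eq_card, Finset.sum_div, Finset.sum_div, sum_conflicted]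
  refine Finset.sum_congr rfl fun v _ => ?_
  by_cases hv : v ∈ conflicted G c
  · simp only [hv, if_true]
    rw [ENNReal.toReal_inv, ENNReal.toReal_natCast, div_eq_inv_mul (_ / _)]
  · simp [hv]

theorem conflictCount_pos (c : ColorAssignment G) (hc : (conflicted G c).Nonempty) :
    1 ≤ conflictCount G c := by
  rw [conflictCount_eq_card]
  exact_mod_cast hc.card_pos

theorem stepMean_sub (h : ColorAssignment G → ℝ) (c : ColorAssignment G)
    (hc : (conflicted G c).Nonempty) :
    stepMean G h c - h c = stepSum G h c / (palette G * conflictCount G c) := by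
  have h1 := conflictCount_pos c hc
  have h2 := one_le_palette (G := G)
  rw [stepMean_of_nonempty h c hc, stepSum, eq_div_iff (by positivity), sub_mul,
    div_mul_cancel₀ _ (by positivity)]
  simp_rw [Finset.sum_sub_distrib, sum_color_const, Finset.sum_const, nsmul_eq_mul]
  rw [conflictCount_eq_card]
  ring

/-- A step moves only to recolorings of a single vertex. -/
theorem stepMean_le_of_forall (h : ColorAssignment G → ℝ) (c : ColorAssignment G)
    (hc : (conflicted G c).Nonempty) (g : ColorAssignment G → ℝ)
    (hg : ∀ v x, h (Function.update c v x) ≤ g (Function.update c v x)) :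
    stepMean G h c ≤ stepMean G g c := by
  have h1 := conflictCount_pos c hc
  have h2 := one_le_palette (G := G)
  rw [stepMean_of_nonempty h c hc, stepMean_of_nonempty g c hc]
  gcongr
  exact hg _ _

theorem integrable_run (t : ℕ) (h : ColorAssignment G → ℝ) :
    Integrable (fun c => h (c t)) (run G) := by
  have : Integrable h ((run G).map fun c => c t) := by
    have : IsProbabilityMeasure ((run G).map fun c => c t) :=
      Measure.isProbabilityMeasure_map (measurable_pi_apply t).aemeasurable
    exact Integrable.of_finite
  exact this.comp_measurable (measurable_pi_apply t)

/-- The Markov property: the joint law of the history up to `t` and the next coloring is the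
composition-product of the history law with `historyKernel`, which reads only the last coordinate.
-/
theorem meanAt_succ (t : ℕ) (h : ColorAssignment G → ℝ) :
    meanAt G (t + 1) h = meanAt G t (stepMean G h) := by
  have key := Kernel.map_frestrictLe_trajMeasure_compProd_eq_map_trajMeasure
    (X := fun _ : ℕ => ColorAssignment G) (μ₀ := (initial G).toMeasure)
    (κ := historyKernel G) (a := t)
  have hh : Measurable h := measurable_of_finite h
  have hs : Measurable (stepMean G h) := measurable_of_finite _
  have hm : Measurable fun x : ℕ → ColorAssignment G =>
      (Preorder.frestrictLe (π := fun _ : ℕ => ColorAssignment G) t x, x (t + 1)) := by fun_prop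
  have hint : Integrable (fun p : ((i : Finset.Iic t) → (fun _ : ℕ => ColorAssignment G) i) ×
      ColorAssignment G => h p.2) ((run G).map fun x : ℕ → ColorAssignment G =>
      (Preorder.frestrictLe (π := fun _ : ℕ => ColorAssignment G) t x, x (t + 1))) := by
    exact (integrable_map_measure (hh.comp measurable_snd).aestronglyMeasurable
      hm.aemeasurable).2 (integrable_run (t + 1) h)
  have e1 : meanAt G (t + 1) h = ∫ p, h p.2 ∂((run G).map fun x : ℕ → ColorAssignment G =>
      (Preorder.frestrictLe (π := fun _ : ℕ => ColorAssignment G) t x, x (t + 1))) := by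
    exact (integral_map hm.aemeasurable (hh.comp measurable_snd).aestronglyMeasurable).symm
  rw [e1]
  rw [run] at hint ⊢
  rw [← key] at hint ⊢
  rw [Measure.integral_compProd hint, integral_map (by fun_prop)]
  · rfl
  · exact (hs.comp (measurable_pi_apply
      (⟨t, Finset.mem_Iic.mpr le_rfl⟩ : Finset.Iic t))).aestronglyMeasurable

theorem meanAt_mono (t : ℕ) {h g : ColorAssignment G → ℝ} (hg : ∀ c, h c ≤ g c) :
    meanAt G t h ≤ meanAt G t g :=
  integral_mono (integrable_run t h) (integrable_run t g) fun c => hg (c t)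

theorem meanAt_const_mul (t : ℕ) (a : ℝ) (h : ColorAssignment G → ℝ) :
    meanAt G t (fun c => a * h c) = a * meanAt G t h :=
  integral_const_mul a _

theorem meanAt_sub (t : ℕ) (h g : ColorAssignment G → ℝ) :
    meanAt G t (fun c => h c - g c) = meanAt G t h - meanAt G t g :=
  integral_sub (integrable_run t h) (integrable_run t g)

theorem meanAt_add (t : ℕ) (h g : ColorAssignment G → ℝ) :
    meanAt G t (fun c => h c + g c) = meanAt G t h + meanAt G t g :=
  integral_add (integrable_run t h) (integrable_run t g)

theorem meanAt_const (t : ℕ) (a : ℝ) : meanAt G t (fun _ => a) = a := by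
  simp [meanAt]

/-- The probability of having terminated by time `t` in terms of the coloring at time `t`. -/
theorem one_sub_meanAt_improper_le (t : ℕ) (s : ℝ) (hts : (t : ℝ) ≤ s) :
    1 - meanAt G t (improper G) ≤ probRuntimeLE G s := by
  have h1 : (run G).real {c | IsProper G (c t)} = 1 - meanAt G t (improper G) := by
    have hms : MeasurableSet {c : ColorAssignment G | IsProper G c} :=
      Set.Finite.measurableSet (Set.toFinite _)
    have hm : MeasurableSet {c : ℕ → ColorAssignment G | IsProper G (c t)} :=
      hms.preimage (measurable_pi_apply t)
    rw [← meanAt_const (G := G) t 1, ← meanAt_sub, meanAt, ← integral_indicator_one hm]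
    refine integral_congr_ae (Filter.Eventually.of_forall fun c => ?_)
    by_cases h : IsProper G (c t)
    · have : ¬ (conflicted G (c t)).Nonempty := by rwa [conflicted_nonempty_iff, not_not]
      simp [improper, this, h]
    · have : (conflicted G (c t)).Nonempty := by rwa [conflicted_nonempty_iff]
      simp [improper, this, h]
  rw [← h1, probRuntimeLE]
  refine measureReal_mono fun c hc => ?_
  have h2 : runtime G c ≤ t := iInf₂_le t hc
  have h3 : ((runtime G c : ℕ∞) : ℝ≥0∞) ≤ ((t : ℕ∞) : ℝ≥0∞) := ENat.toENNReal_le.2 h2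
  refine h3.trans ?_
  rw [ENat.toENNReal_coe, ← ENNReal.ofReal_natCast]
  exact ENNReal.ofReal_le_ofReal hts

theorem stepMean_improper_le (c : ColorAssignment G) :
    stepMean G (improper G) c ≤ improper G c := by
  by_cases hc : (conflicted G c).Nonempty
  · have : stepMean G (improper G) c ≤ stepMean G (fun _ => 1) c :=
      stepMean_le_of_forall _ c hc _ fun v x => by rw [improper]; split_ifs <;> norm_num
    simpa [stepMean, improper, hc] using this
  · rw [stepMean_of_not_nonempty _ _ hc]

theorem meanAt_improper_antitone : Antitone fun t => meanAt G t (improper G) :=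
  antitone_nat_of_succ_le fun t => by
    rw [meanAt_succ]
    exact meanAt_mono t stepMean_improper_le

end

/-! ### Decay of the potential and of the failure probability -/

section
variable {V : Type*} [Fintype V] [DecidableEq V] (G : SimpleGraph V) [DecidableRel G.Adj]

/-- The rate at which the potential decreases. -/
noncomputable def driftRate (V : Type*) [Fintype V] : ℝ := 1 / (1120 * Fintype.card V)

/-- The squared excess of the potential over the level `x`, on colorings that are not proper. -/
noncomputable def squaredExcess (x : ℝ) (c : ColorAssignment G) : ℝ :=
  improper G c * max (potential G c - x) 0 ^ 2

variable {G}

theorem improper_nonneg (c : ColorAssignment G) : 0 ≤ improper G c := by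
  rw [improper]; split_ifs <;> norm_num

theorem improper_le_one (c : ColorAssignment G) : improper G c ≤ 1 := by
  rw [improper]; split_ifs <;> norm_num

theorem driftRate_nonneg : 0 ≤ driftRate V := by
  rw [driftRate]; positivity

theorem driftRate_le_one : driftRate V ≤ 1 := by
  rw [driftRate]
  rcases Nat.eq_zero_or_pos (Fintype.card V) with h | h
  · simp [h]
  · have : (1 : ℝ) ≤ Fintype.card V := by exact_mod_cast h
    rw [div_le_one (by positivity)]; linarith

theorem stepMean_potential_le_mul (c : ColorAssignment G) :
    stepMean G (potential G) c ≤ (1 - driftRate V) * potential G c := by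
  by_cases hc : (conflicted G c).Nonempty
  · have h1 := conflictCount_pos c hc
    have h2 := one_le_palette (G := G)
    have h3 := stepMean_sub (potential G) c hc
    have h4 : stepSum G (potential G) c / (palette G * conflictCount G c) ≤
        -(driftRate V * potential G c) := by
      rw [div_le_iff₀ (by positivity)]
      refine (stepSum_potential_le_neg_potential c).trans (le_of_eq ?_)
      rw [driftRate]; ring
    linarith
  · rw [stepMean_of_not_nonempty _ _ hc]
    have h0 : potential G c = 0 := by
      have hp := potential_nonneg c
      have hq := potential_le c
      have hm : monoSum G c = 0 := by
        rw [← sum_conflicted_monoSum, Finset.not_nonempty_iff_eq_empty.1 hc, Finset.sum_empty]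
      have hn : conflictCount G c = 0 := by
        rw [conflictCount_eq_card, Finset.not_nonempty_iff_eq_empty.1 hc]; simp
      linarith
    simp [h0]

theorem stepMean_potential_le_sub (c : ColorAssignment G) :
    stepMean G (potential G) c ≤ potential G c - improper G c / (2 * palette G) := by
  by_cases hc : (conflicted G c).Nonempty
  · have h1 := conflictCount_pos c hc
    have h2 := one_le_palette (G := G)
    have h3 := stepMean_sub (potential G) c hc
    have h4 : stepSum G (potential G) c / (palette G * conflictCount G c) ≤
        -(1 / (2 * palette G)) := by
      rw [div_le_iff₀ (by positivity)]
      refine (stepSum_potential_le_neg_conflictCount c).trans (le_of_eq ?_)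
      field_simp
    rw [improper, if_pos hc]
    linarith
  · rw [stepMean_of_not_nonempty _ _ hc, improper, if_neg hc]
    simp

theorem meanAt_potential_le (t : ℕ) :
    meanAt G t (potential G) ≤ (1 - driftRate V) ^ t * (palette G * Fintype.card V) := by
  induction t with
  | zero =>
    rw [pow_zero, one_mul]
    exact (meanAt_mono 0 potential_le_card).trans_eq (meanAt_const 0 _)
  | succ t ih =>
    rw [meanAt_succ, pow_succ', mul_assoc]
    refine (meanAt_mono t stepMean_potential_le_mul).trans ?_
    rw [meanAt_const_mul]
    exact mul_le_mul_of_nonneg_left ih (by linarith [driftRate_le_one (V := V)])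

/-- Additive drift: as long as the run is improper the mean of Φ falls by 1/(2k) per step, and Φ
cannot become negative. -/
theorem mul_meanAt_improper_le (t s : ℕ) :
    s * meanAt G (t + s) (improper G) ≤ 2 * palette G * meanAt G t (potential G) := by
  have hk := one_le_palette (G := G)
  have key : ∀ r ≤ s, meanAt G (t + r) (potential G) ≤
      meanAt G t (potential G) - r * (meanAt G (t + s) (improper G) / (2 * palette G)) := by
    intro r
    induction r with
    | zero => intro _; simp
    | succ r ih =>
      intro hr
      have h1 := ih (by omega)
      rw [← add_assoc, meanAt_succ]
      refine (meanAt_mono _ stepMean_potential_le_sub).trans ?_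
      rw [meanAt_sub]
      have h2 : meanAt G (t + r) (fun c => improper G c / (2 * palette G)) =
          meanAt G (t + r) (improper G) / (2 * palette G) := integral_div _ _
      -- Proper colorings are absorbing, so the failure probability at the final time bounds all
      -- earlier ones from below.
      have h3 : meanAt G (t + s) (improper G) / (2 * palette G) ≤
          meanAt G (t + r) (improper G) / (2 * palette G) := by
        gcongr
        exact meanAt_improper_antitone (by omega)
      rw [h2]
      push_cast
      linarith
  have h1 := key s le_rfl
  have h2 : 0 ≤ meanAt G (t + s) (potential G) := integral_nonneg fun c => potential_nonneg _
  have h3 : s * (meanAt G (t + s) (improper G) / (2 * palette G)) ≤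
      meanAt G t (potential G) := by linarith
  rw [← mul_div_assoc, div_le_iff₀ (by positivity)] at h3
  linarith

theorem stepMean_affine (a b : ℝ) (h : ColorAssignment G → ℝ) (c : ColorAssignment G) :
    stepMean G (fun c' => a * h c' + b) c = a * stepMean G h c + b := by
  simp only [stepMean]
  rw [integral_add Integrable.of_finite Integrable.of_finite, integral_const_mul]
  simp

theorem max_add_sq_le (z w : ℝ) : max (z + w) 0 ^ 2 ≤ max z 0 ^ 2 + 2 * max z 0 * w + w ^ 2 := by
  rcases le_total z 0 with h | h
  · rw [max_eq_right h]
    rcases le_total (z + w) 0 with h' | h'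
    · rw [max_eq_right h']; nlinarith [sq_nonneg w]
    · rw [max_eq_left h']; nlinarith
  · rw [max_eq_left h]
    rcases le_total (z + w) 0 with h' | h'
    · rw [max_eq_right h']; nlinarith [sq_nonneg (z + w)]
    · rw [max_eq_left h']; nlinarith

/-- Expanding the square, the linear term is twice the excess times the drift relative to the moving
level. It is never positive, because the excess vanishes unless Φ > x, where the drift is at most
−δ. Only the squared increment remains, at most (4k + δ)². The factor `improper` discards finished
runs, whose potential stays at 0 while the level continues to fall. -/
theorem stepMean_squaredExcess_le {x δ : ℝ} (hδ : 0 ≤ δ) (hδ' : δ ≤ palette G)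
    (hx : ∀ c, (conflicted G c).Nonempty → x < potential G c →
      stepMean G (potential G) c ≤ potential G c - δ) (c : ColorAssignment G) :
    stepMean G (squaredExcess G (x - δ)) c ≤ squaredExcess G x c + (5 * palette G) ^ 2 := by
  have hk := one_le_palette (G := G)
  by_cases hc : (conflicted G c).Nonempty
  · set m := max (potential G c - x) 0 with hm
    have hm0 : 0 ≤ m := le_max_right _ _
    have h1 : stepMean G (squaredExcess G (x - δ)) c ≤ stepMean G (fun c' =>
        2 * m * potential G c' +
          (m ^ 2 + 2 * m * (δ - potential G c) + (5 * palette G) ^ 2)) c := by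
      refine stepMean_le_of_forall _ c hc _ fun v y => ?_
      have h2 := abs_le.1 (abs_potential_update_sub_le c v y)
      set p := potential G (Function.update c v y)
      have h3 := max_add_sq_le (potential G c - x) (p - potential G c + δ)
      have h4 : squaredExcess G (x - δ) (Function.update c v y) ≤
          max (potential G c - x + (p - potential G c + δ)) 0 ^ 2 := by
        rw [squaredExcess, show potential G c - x + (p - potential G c + δ) = p - (x - δ) by ring]
        exact mul_le_of_le_one_left (by positivity) (improper_le_one _)
      have h5 : (p - potential G c + δ) ^ 2 ≤ (5 * palette G) ^ 2 :=
        sq_le_sq' (by linarith [h2.1]) (by linarith [h2.2])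
      rw [← hm] at h3
      linarith
    refine h1.trans ?_
    rw [stepMean_affine, squaredExcess, improper, if_pos hc, one_mul]
    rcases le_or_gt (potential G c) x with h | h
    · have : m = 0 := max_eq_right (by linarith)
      rw [← hm, this]; simp
    · have := mul_le_mul_of_nonneg_left (hx c hc h) (by positivity : 0 ≤ 2 * m)
      linarith
  · rw [stepMean_of_not_nonempty _ _ hc, squaredExcess, squaredExcess, improper, if_neg hc]
    simp only [zero_mul, zero_add]
    positivity

theorem squaredExcess_antitone {x y : ℝ} (h : x ≤ y) (c : ColorAssignment G) :
    squaredExcess G y c ≤ squaredExcess G x c := by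
  have := improper_nonneg c
  rw [squaredExcess, squaredExcess]
  gcongr

theorem meanAt_succ_squaredExcess_le (t : ℕ) {x δ : ℝ} (hδ : 0 ≤ δ) (hδ' : δ ≤ palette G)
    (hx : ∀ c, (conflicted G c).Nonempty → x < potential G c →
      stepMean G (potential G) c ≤ potential G c - δ) :
    meanAt G (t + 1) (squaredExcess G (x - δ)) ≤
      meanAt G t (squaredExcess G x) + (5 * palette G) ^ 2 := by
  rw [meanAt_succ]
  refine (meanAt_mono t (stepMean_squaredExcess_le hδ hδ' hx)).trans_eq ?_
  rw [meanAt_add, meanAt_const]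

/-- The level starts at kn, above every value of Φ, so the initial excess is 0; it then falls at the
rate of the multiplicative drift. -/
theorem meanAt_squaredExcess_geometric_le (t : ℕ) :
    meanAt G t (squaredExcess G ((1 - driftRate V) ^ t * (palette G * Fintype.card V))) ≤
      t * (5 * palette G) ^ 2 := by
  have hk := one_le_palette (G := G)
  induction t with
  | zero =>
    refine (meanAt_mono 0 (g := fun _ => 0) fun c => ?_).trans_eq (by simp [meanAt_const])
    rw [squaredExcess, pow_zero, one_mul, max_eq_right (by linarith [potential_le_card c])]
    simp
  | succ t ih =>
    set x := (1 - driftRate V) ^ t * (palette G * Fintype.card V) with hx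
    have hr0 := driftRate_nonneg (V := V)
    have hr1 := driftRate_le_one (V := V)
    have hx0 : 0 ≤ x := mul_nonneg (pow_nonneg (by linarith) _) (by positivity)
    have hx1 : x ≤ palette G * Fintype.card V :=
      mul_le_of_le_one_left (by positivity) (pow_le_one₀ (by linarith) (by linarith))
    have hd : driftRate V * x ≤ palette G := by
      refine (mul_le_mul_of_nonneg_left hx1 hr0).trans ?_
      rw [driftRate]
      rcases Nat.eq_zero_or_pos (Fintype.card V) with h | h
      · simp [h]; linarith
      · have : (1 : ℝ) ≤ Fintype.card V := by exact_mod_cast h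
        rw [div_mul_eq_mul_div, div_le_iff₀ (by positivity)]
        nlinarith
    have h := meanAt_succ_squaredExcess_le (G := G) t (x := x) (mul_nonneg hr0 hx0) hd
      fun c _ hxc => (stepMean_potential_le_mul c).trans (by
        linarith [mul_le_mul_of_nonneg_left hxc.le hr0])
    rw [pow_succ', mul_assoc, ← hx, sub_mul, one_mul]
    push_cast
    linarith

theorem meanAt_squaredExcess_linear_le (t s : ℕ) (y : ℝ) :
    meanAt G (t + s) (squaredExcess G (y - s * (1 / (2 * palette G)))) ≤
      meanAt G t (squaredExcess G y) + s * (5 * palette G) ^ 2 := by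
  have hk := one_le_palette (G := G)
  induction s with
  | zero => simp
  | succ s ih =>
    have hd : 1 / (2 * palette G) ≤ palette G := by
      rw [div_le_iff₀ (by positivity)]; nlinarith
    have h := meanAt_succ_squaredExcess_le (G := G) (t + s)
      (x := y - s * (1 / (2 * palette G))) (by positivity) hd fun c hc _ => by
        have := stepMean_potential_le_sub c
        rwa [improper, if_pos hc] at this
    rw [← add_assoc]
    push_cast
    rw [show y - (s + 1) * (1 / (2 * palette G)) =
      y - s * (1 / (2 * palette G)) - 1 / (2 * palette G) by ring]
    linarith

theorem sq_mul_meanAt_improper_le (t : ℕ) {x : ℝ} (hx : 0 ≤ x) :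
    x ^ 2 * meanAt G t (improper G) ≤ meanAt G t (squaredExcess G (-x)) := by
  rw [← meanAt_const_mul]
  refine meanAt_mono t fun c => ?_
  rw [squaredExcess, mul_comm]
  refine mul_le_mul_of_nonneg_left ?_ (improper_nonneg c)
  refine pow_le_pow_left₀ hx ((le_max_left _ _).trans' ?_) 2
  linarith [potential_nonneg c]

/-- The constant is 3360 = 3 · 1120: three times log k at rate 1/(1120n) gives the factor k⁻³. -/
theorem geometric_le_of_le (hn : 0 < Fintype.card V) (t : ℕ)
    (ht : 3360 * Fintype.card V * Real.log (palette G) ≤ t) :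
    (1 - driftRate V) ^ t ≤ 1 / palette G ^ 3 := by
  have hk := one_le_palette (G := G)
  have hn' : (0 : ℝ) < Fintype.card V := by exact_mod_cast hn
  have h1 : (1 - driftRate V) ^ t ≤ Real.exp (-driftRate V) ^ t := by
    refine pow_le_pow_left₀ (by linarith [driftRate_le_one (V := V)]) ?_ t
    linarith [Real.add_one_le_exp (-driftRate V)]
  refine h1.trans ?_
  rw [← Real.exp_nat_mul, one_div, ← Real.exp_log (by positivity : 0 < (palette G ^ 3)⁻¹),
    Real.exp_le_exp, Real.log_inv, Real.log_pow, driftRate]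
  have h2 : 3 * Real.log (palette G) ≤ t * (1 / (1120 * Fintype.card V)) := by
    rw [mul_one_div, le_div_iff₀ (by positivity)]
    linarith
  push_cast
  linarith

theorem meanAt_improper_le_of_le (hn : 0 < Fintype.card V) (t : ℕ)
    (ht : 3360 * Fintype.card V * Real.log (palette G) ≤ t) :
    meanAt G (t + 4 * Fintype.card V) (improper G) ≤ 2 / palette G := by
  have hk := one_le_palette (G := G)
  have hn' : (0 : ℝ) < Fintype.card V := by exact_mod_cast hn
  have h1 := geometric_le_of_le (G := G) hn t ht
  have h2 := mul_meanAt_improper_le (G := G) t (4 * Fintype.card V)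
  have h3 := meanAt_potential_le (G := G) t
  set q := meanAt G (t + 4 * Fintype.card V) (improper G) with hq
  have hq0 : 0 ≤ q := integral_nonneg fun c => improper_nonneg _
  have h4 : meanAt G t (potential G) ≤ 1 / palette G ^ 3 * (palette G * Fintype.card V) :=
    h3.trans (by gcongr)
  have h5 := mul_le_mul_of_nonneg_left h4 (by positivity : 0 ≤ 2 * palette G)
  have h6 : 2 * palette G * (1 / palette G ^ 3 * (palette G * Fintype.card V)) =
      Fintype.card V * (2 / palette G) := by
    field_simp
  push_cast at h2
  have h7 : (Fintype.card V : ℝ) * q ≤ Fintype.card V * (2 / palette G) := by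
    have := mul_nonneg hn'.le hq0
    linarith
  exact le_of_mul_le_mul_left h7 hn'

/-- The level is at most n/k after the geometric phase, and 4n steps of additive drift lower it by
2n/k, to −n/k. As Φ ≥ 0, an improper coloring then has squared excess at least (n/k)², and Markov's
inequality applies. -/
theorem meanAt_improper_le_of_le' (hn : 0 < Fintype.card V) (t : ℕ)
    (ht : 3360 * Fintype.card V * Real.log (palette G) ≤ t) :
    meanAt G (t + 4 * Fintype.card V) (improper G) ≤
      25 * palette G ^ 4 * (t + 4 * Fintype.card V) / (Fintype.card V : ℝ) ^ 2 := by
  have hk := one_le_palette (G := G)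
  have hn' : (0 : ℝ) < Fintype.card V := by exact_mod_cast hn
  have h1 := geometric_le_of_le (G := G) hn t ht
  set n : ℝ := (Fintype.card V : ℝ) with hndef
  have h2 : (1 - driftRate V) ^ t * (palette G * n) ≤ n / palette G := by
    have : 1 / palette G ^ 3 * (palette G * n) = n / palette G / palette G := by
      field_simp
    refine (mul_le_mul_of_nonneg_right h1 (by positivity)).trans ?_
    rw [this]
    exact div_le_self (by positivity) hk
  have h3 := (meanAt_mono t (squaredExcess_antitone (G := G) h2)).trans
    (meanAt_squaredExcess_geometric_le t)
  have h4 := meanAt_squaredExcess_linear_le (G := G) t (4 * Fintype.card V) (n / palette G)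
  have h5 := sq_mul_meanAt_improper_le (G := G) (t + 4 * Fintype.card V)
    (by positivity : 0 ≤ n / palette G)
  push_cast at h4
  rw [show n / palette G - 4 * n * (1 / (2 * palette G)) = -(n / palette G) by
    field_simp; ring] at h4
  rw [le_div_iff₀ (by positivity)]
  set q := meanAt G (t + 4 * Fintype.card V) (improper G)
  have h6 : (n / palette G) ^ 2 * q ≤ (t + 4 * n) * (5 * palette G) ^ 2 := by linarith
  rw [div_pow, div_mul_eq_mul_div, div_le_iff₀ (by positivity)] at h6
  linarith

theorem one_sub_le_probRuntimeLE (hn : 0 < Fintype.card V) {ε : ℝ} (hε : 0 < ε)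
    (hN : 100000 * (2 / ε) ^ 5 / ε ≤ Fintype.card V) :
    1 - ε ≤ probRuntimeLE G
      (10000 * (Fintype.card V * Real.log (max (G.maxDegree : ℝ) 2))) := by
  have hk := one_le_palette (G := G)
  have hn1 : (1 : ℝ) ≤ Fintype.card V := by exact_mod_cast hn
  have hlogk : 0 ≤ Real.log (palette G) := Real.log_nonneg hk
  set t := ⌈3360 * Fintype.card V * Real.log (palette G)⌉₊ with ht
  have ht1 : 3360 * Fintype.card V * Real.log (palette G) ≤ t := Nat.le_ceil _
  have ht2 : (t : ℝ) < 3360 * Fintype.card V * Real.log (palette G) + 1 :=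
    Nat.ceil_lt_add_one (by positivity)
  have hq1 := meanAt_improper_le_of_le (G := G) hn t ht1
  have hq2 := meanAt_improper_le_of_le' (G := G) hn t ht1
  set n : ℝ := (Fintype.card V : ℝ) with hndef
  set L := Real.log (max (G.maxDegree : ℝ) 2) with hL
  have hL2 : 1 / 2 ≤ L := by
    have : Real.log 2 ≤ L := Real.log_le_log (by norm_num) (le_max_right _ _)
    linarith [Real.log_two_gt_d9]
  -- With m = max(Δ, 2), k ≤ m + 1 ≤ m².
  have hkL : Real.log (palette G) ≤ 2 * L := by
    have h2 : (2 : ℝ) * L = Real.log (max (G.maxDegree : ℝ) 2 ^ 2) := by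
      rw [Real.log_pow]; push_cast; ring
    rw [h2]
    refine Real.log_le_log (by positivity) ?_
    rw [palette]
    have a1 := le_max_left (G.maxDegree : ℝ) 2
    have a2 := le_max_right (G.maxDegree : ℝ) 2
    nlinarith
  have htime : ((t + 4 * Fintype.card V : ℕ) : ℝ) ≤ 10000 * (n * L) := by
    push_cast
    rw [← hndef]
    have b1 := mul_le_mul_of_nonneg_left hkL (by linarith : 0 ≤ n)
    have b2 := mul_le_mul_of_nonneg_left hL2 (by linarith : 0 ≤ n)
    linarith
  refine le_trans ?_ (one_sub_meanAt_improper_le (t + 4 * Fintype.card V) _ htime)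
  suffices h : meanAt G (t + 4 * Fintype.card V) (improper G) ≤ ε by linarith
  -- For k ≥ 2/ε the bound 2/k is already at most ε. For smaller k the second-moment bound is at
  -- most 100000 k⁵/n, which the lower bound on n makes at most ε.
  rcases le_total (2 / ε) (palette G) with hc | hc
  · refine hq1.trans ?_
    rw [div_le_iff₀ hε] at hc
    rw [div_le_iff₀ (by positivity)]
    linarith
  · refine hq2.trans ?_
    have c1 : Real.log (palette G) ≤ palette G := Real.log_le_self (by linarith)
    have c2 : (t : ℝ) + 4 * n ≤ 4000 * (n * palette G) := by
      have d1 := mul_le_mul_of_nonneg_left c1 (by linarith : 0 ≤ n)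
      have d2 := mul_le_mul_of_nonneg_left hk (by linarith : 0 ≤ n)
      linarith
    have c3 : palette G ^ 5 ≤ (2 / ε) ^ 5 := pow_le_pow_left₀ (by linarith) hc 5
    rw [div_le_iff₀ hε] at hN
    rw [div_le_iff₀ (by positivity)]
    calc 25 * palette G ^ 4 * (t + 4 * n) ≤ 25 * palette G ^ 4 * (4000 * (n * palette G)) := by
          gcongr
      _ = n * (100000 * palette G ^ 5) := by ring
      _ ≤ n * (100000 * (2 / ε) ^ 5) := by gcongr
      _ ≤ n * (n * ε) := by gcongr
      _ = ε * n ^ 2 := by ring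

end

end DecentralizedColoring

/-! ### Both regimes from the uniform bound -/

theorem mainTheorem5 :
    -- graphs with `Δ = O(n ^ (1 / 4))`
    (∃ C : ℝ, 0 < C ∧ ∀ K : ℝ, 0 < K → ∀ ε : ℝ, 0 < ε → ∃ N : ℕ, ∀ n : ℕ, N ≤ n →
      ∀ (G : SimpleGraph (Fin n)) [DecidableRel G.Adj],
        (G.maxDegree : ℝ) ≤ K * (n : ℝ) ^ (1 / 4 : ℝ) →
          1 - ε ≤ DecentralizedColoring.probRuntimeLE G
            (C * (n * Real.log (max (G.maxDegree : ℝ) 2)))) ∧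
    -- all graphs
    (∃ C : ℝ, 0 < C ∧ ∀ ε : ℝ, 0 < ε → ∃ N : ℕ, ∀ n : ℕ, N ≤ n →
      ∀ (G : SimpleGraph (Fin n)) [DecidableRel G.Adj],
        1 - ε ≤ DecentralizedColoring.probRuntimeLE G
          (C * (n * Real.log (max (G.maxDegree : ℝ) 2)))) := by
  have key : ∀ ε : ℝ, 0 < ε → ∃ N : ℕ, ∀ n : ℕ, N ≤ n →
      ∀ (G : SimpleGraph (Fin n)) [DecidableRel G.Adj],
        1 - ε ≤ DecentralizedColoring.probRuntimeLE G
          (10000 * (n * Real.log (max (G.maxDegree : ℝ) 2))) := by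
    intro ε hε
    refine ⟨⌈100000 * (2 / ε) ^ 5 / ε⌉₊ + 1, fun n hn G _ => ?_⟩
    have h1 : 100000 * (2 / ε) ^ 5 / ε ≤ n :=
      (Nat.le_ceil _).trans (by exact_mod_cast (by omega : ⌈100000 * (2 / ε) ^ 5 / ε⌉₊ ≤ n))
    have h2 := DecentralizedColoring.one_sub_le_probRuntimeLE (G := G)
      (by rw [Fintype.card_fin]; omega) hε (by rwa [Fintype.card_fin])
    rwa [Fintype.card_fin] at h2
  refine ⟨⟨10000, by norm_num, fun K _ ε hε => ?_⟩, 10000, by norm_num, key⟩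
  obtain ⟨N, hN⟩ := key ε hε
  exact ⟨N, fun n hn G _ _ => hN n hn G⟩
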